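/- Let $k$ be a field of characteristic different from $2$. A minimal algebra over $k$ generated in degree $1$ is a commutative differential graded algebra $(\wedge V,d)$, where $\wedge V$ is the exterior algebra of a $k$-vector space $V$ placed in degree $1$, such that $V$ has a basis $(x_\tau)$, indexed by a well-ordered set, with each $dx_\tau$ in the subalgebra generated by the $x_\mu$, $\mu<\tau$. Its dimension is $\dim V$. Its characteristic filtration is $W_0=V\cap\ker d$, $W_{i+1}=\{v\in V: dv\in\wedge^2W_i\}$, its length is the least $n\ge 1$ with $W_{n-1}=V$, and one sets $F_0=W_0$, $F_i=W_i/W_{i-1}$ for $i\ge 1$. The algebra has type $(4,3)$ if it has dimension $7$, length $2$, $\dim F_0=4$ and $\dim F_1=3$. Then $d$ induces an injection $F_1\hookrightarrow\wedge^2F_0$, and one obtains a plane $\pi=\mathbb{P}(d(F_1))$ in $\mathbb{P}(\wedge^2F_0)\cong\mathbb{P}^5$, which contains the Klein quadric $\mathcal{Q}=\{[\varphi]:\varphi\wedge\varphi=0\}$. The plane $\pi$ cuts $\mathcal{Q}$ in a smooth conic if the quadratic form $\varphi\mapsto\varphi\wedge\varphi\in\wedge^4F_0\cong k$ restricted to the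 three-dimensional space $d(F_1)$ is regular, that is, has a nonsingular matrix (the conic need not have a $k$-rational point). Then the number of isomorphism classes (as commutative differential graded algebras) of minimal algebras over $k$, generated in degree $1$, of dimension $7$ and type $(4,3)$, for which $\pi$ cuts $\mathcal{Q}$ in a smooth conic, equals (as a cardinal number) the number of isomorphism classes of quaternion algebras $(a,b)$, $a,b\in k^*$, over $k$; here $(a,b)$ is the $k$-algebra with basis $1,i,j,ij$ and $i^2=a$, $j^2=b$, $ij=-ji$. -/

import Mathlib

universe u

open scoped Quaternion

noncomputable section

namespace TwoStepMinimal

/-- A commutative differential graded algebra over `k`: a graded `k`-algebra `A = ⨁ 𝒜 p` with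
`x y = (-1)^(p q) y x` for `x ∈ 𝒜 p`, `y ∈ 𝒜 q`, together with a differential `d` of degree `+1`
satisfying the graded Leibniz rule. -/
structure IsCDGA {k A : Type u} [Field k] [Ring A] [Algebra k A]
    (𝒜 : ℕ → Submodule k A) [GradedAlgebra 𝒜] (d : A →ₗ[k] A) : Prop where
  graded_comm : ∀ p q : ℕ, ∀ x ∈ 𝒜 p, ∀ y ∈ 𝒜 q, x * y = (-1) ^ (p * q) * (y * x)
  degree : ∀ p : ℕ, ∀ x ∈ 𝒜 p, d x ∈ 𝒜 (p + 1)
  d_d : ∀ x, d (d x) = 0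
  leibniz : ∀ p q : ℕ, ∀ x ∈ 𝒜 p, ∀ y ∈ 𝒜 q, d (x * y) = d x * y + (-1) ^ p * (x * d y)

/-- A minimal algebra `(⋀V, d)` over `k` generated in degree `1`. The free graded commutative
algebra on a vector space `V` placed in degree `1` is the exterior algebra of `V`, with the
grading by exterior powers. There is a basis `x τ` of `V`, indexed by a well ordered set, such
that each `d (x τ)` is a polynomial expression in the preceding `x μ`, `μ < τ`. -/
structure MinimalAlgebra (k : Type u) [Field k] where
  V : Type u
  [addCommGroup : AddCommGroup V]
  [module : Module k V]
  d : ExteriorAlgebra k V →ₗ[k] ExteriorAlgebra k V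
  isCDGA : IsCDGA (fun p : ℕ => ⋀[k]^p V) d
  minimal : ∃ (I : Type u) (_ : LinearOrder I) (_ : WellFoundedLT I) (x : Module.Basis I k V),
    ∀ τ : I, d (ExteriorAlgebra.ι k (x τ)) ∈
      Algebra.adjoin k ((fun μ => ExteriorAlgebra.ι k (x μ)) '' Set.Iio τ)

attribute [instance] MinimalAlgebra.addCommGroup MinimalAlgebra.module

namespace MinimalAlgebra

variable {k : Type u} [Field k]

/-- Isomorphism of CDGAs: an algebra isomorphism that preserves the degree and commutes with the
differentials. -/
def Iso (M N : MinimalAlgebra k) : Prop :=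
  ∃ f : ExteriorAlgebra k M.V ≃ₐ[k] ExteriorAlgebra k N.V,
    (∀ (p : ℕ) (x : ExteriorAlgebra k M.V), f x ∈ ⋀[k]^p N.V ↔ x ∈ ⋀[k]^p M.V) ∧
    ∀ x, f (M.d x) = N.d (f x)

theorem Iso.refl (M : MinimalAlgebra k) : M.Iso M :=
  ⟨AlgEquiv.refl, fun _ _ => Iff.rfl, fun _ => rfl⟩

theorem Iso.symm {M N : MinimalAlgebra k} (h : M.Iso N) : N.Iso M := by
  obtain ⟨f, h1, h2⟩ := h
  refine ⟨f.symm, fun p x => ?_, fun x => ?_⟩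
  · rw [← h1 p (f.symm x), AlgEquiv.apply_symm_apply]
  · apply f.injective
    rw [h2, AlgEquiv.apply_symm_apply, AlgEquiv.apply_symm_apply]

theorem Iso.trans {M N P : MinimalAlgebra k} (h : M.Iso N) (h' : N.Iso P) : M.Iso P := by
  obtain ⟨f, h1, h2⟩ := h
  obtain ⟨g, h3, h4⟩ := h'
  refine ⟨f.trans g, fun p x => ?_, fun x => ?_⟩
  · rw [AlgEquiv.trans_apply, h3, h1]
  · rw [AlgEquiv.trans_apply, AlgEquiv.trans_apply, h2, h4]

variable (M : MinimalAlgebra k)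

/-- The characteristic filtration of `V`: `W 0 = ker d ∩ V` and `W (i + 1) = d⁻¹(⋀²(W i))`. -/
def W : ℕ → Submodule k M.V
  | 0 => (LinearMap.ker M.d).comap (ExteriorAlgebra.ι k)
  | i + 1 => (((W i).map (ExteriorAlgebra.ι k)) ^ 2).comap (M.d ∘ₗ ExteriorAlgebra.ι k)

/-- `(⋀V, d)` has length `n`: `n` is the least positive integer with `W (n - 1) = V`. -/
def HasLength (n : ℕ) : Prop :=
  IsLeast {m : ℕ | 1 ≤ m ∧ M.W (m - 1) = ⊤} n

/-- The numbers `f 0 = dim (W 0)` and `f (i + 1) = dim (W (i + 1) / W i)`. -/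
def f : ℕ → ℕ
  | 0 => Module.finrank k (M.W 0)
  | i + 1 => Module.finrank k (M.W (i + 1) ⧸ (M.W i).submoduleOf (M.W (i + 1)))

/-- Dimension `7`, length `2`, and type `(f 0, f 1) = (4, 3)`. -/
def IsTypeFourThree : Prop :=
  Module.finrank k M.V = 7 ∧ M.HasLength 2 ∧ M.f 0 = 4 ∧ M.f 1 = 3

/-- The space of bivectors `d(F₁)` inside `⋀²F₀`, where `F₀ = W 0` and `F₁ = W 1 / W 0`: it
consists of the elements of `⋀²F₀` whose image in `⋀²V` is of the form `d v` with `v ∈ W 1`.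
(All elements `d v`, `v ∈ W 1`, come from `⋀²F₀`, and `⋀²F₀` embeds in `⋀²V`.)
Its projectivization is the plane `π`. -/
def bivectors : Submodule k (⋀[k]^2 (M.W 0)) :=
  ((M.W 1).map (M.d ∘ₗ ExteriorAlgebra.ι k)).comap
    ((ExteriorAlgebra.map (M.W 0).subtype).toLinearMap ∘ₗ (⋀[k]^2 (M.W 0)).subtype)

end MinimalAlgebra

section Klein

variable {k : Type u} [Field k] {U : Type u} [AddCommGroup U] [Module k U]

/-- The product `⋀²U × ⋀²U → ⋀⁴U`. -/
def wedge : (⋀[k]^2 U) →ₗ[k] (⋀[k]^2 U) →ₗ[k] (⋀[k]^4 U) :=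
  LinearMap.mk₂ k
    (fun φ ψ => ⟨(φ : ExteriorAlgebra k U) * (ψ : ExteriorAlgebra k U),
      SetLike.mul_mem_graded (A := fun i : ℕ => ⋀[k]^i U) φ.2 ψ.2⟩)
    (fun _ _ _ => Subtype.ext (add_mul _ _ _))
    (fun _ _ _ => Subtype.ext (smul_mul_assoc _ _ _))
    (fun _ _ _ => Subtype.ext (mul_add _ _ _))
    (fun _ _ _ => Subtype.ext (mul_smul_comm _ _ _))

/-- For `U` of dimension `4` and an identification of the line `⋀⁴U` with `k`, the quadratic form
`φ ↦ φ ∧ φ` on `⋀²U`, whose zero locus in `ℙ(⋀²U)` is the Klein quadric. Another identification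
multiplies the form by a nonzero scalar. -/
def kleinForm (vol : (⋀[k]^4 U) ≃ₗ[k] k) : QuadraticForm k (⋀[k]^2 U) :=
  LinearMap.BilinMap.toQuadraticMap ((wedge (k := k) (U := U)).compr₂ vol.toLinearMap)

/-- The projectivization of `D ⊆ ⋀²U` is a plane that cuts the Klein quadric in a smooth conic:
`D` is three-dimensional and the quadratic form on `D` that defines the intersection is regular
(its symmetric matrix is nonsingular, so that the conic is smooth, with or without rational
points). -/
def CutsSmoothConic (D : Submodule k (⋀[k]^2 U)) : Prop :=
  Module.finrank k D = 3 ∧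
    ∃ vol : (⋀[k]^4 U) ≃ₗ[k] k,
      (QuadraticMap.polarBilin (R := k) (M := D) (N := k)
        ((kleinForm vol).comp D.subtype)).Nondegenerate

end Klein

variable (k : Type u) [Field k]

/-- The minimal algebras of dimension `7` and type `(4, 3)` whose plane `π` cuts the Klein quadric
in `ℙ(⋀²F₀)` in a smooth conic. -/
def SmoothConicAlgebra : Type (u + 1) :=
  {M : MinimalAlgebra k // M.IsTypeFourThree ∧ CutsSmoothConic M.bivectors}

/-- Isomorphism of minimal algebras, as an equivalence relation. -/
def algebraSetoid : Setoid (SmoothConicAlgebra k) where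
  r M N := M.1.Iso N.1
  iseqv := ⟨fun M => MinimalAlgebra.Iso.refl M.1, fun h => h.symm, fun h h' => h.trans h'⟩

/-- Isomorphism of `k`-algebras, as an equivalence relation on the quaternion algebras `(a, b)`
with `a, b ∈ kˣ`; in `(a, b) = ℍ[k, a, b]` one has `i² = a`, `j² = b`, `ij = -ji`. -/
def quaternionSetoid : Setoid (kˣ × kˣ) where
  r p q := Nonempty (ℍ[k, (p.1 : k), (p.2 : k)] ≃ₐ[k] ℍ[k, (q.1 : k), (q.2 : k)])
  iseqv := ⟨fun _ => ⟨AlgEquiv.refl⟩, fun ⟨e⟩ => ⟨e.symm⟩, fun ⟨e⟩ ⟨e'⟩ => ⟨e.trans e'⟩⟩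

end TwoStepMinimal

end

/-! Write U for F₀ and D for d(F₁) ⊆ ⋀²U. A bivector on U is an alternating form on the dual U*.
Reading the values of a linear form on a basis e₀, …, e₃ as the coordinates of a quaternion turns U*
into (a, b), and the bivector with coefficients y₀, y₁, y₂ in `normalForm a b` into (x, x') ↦ ω(yx,
x'), where y = y₀ + y₁i + y₂j and ω = `quatForm` is nondegenerate (`bform_normalForm`). So D records
left multiplication by the span of 1, i, j, followed by ω. The bijection sends the class of (a, b)
to the algebra `model a b` built from this D.

Surjectivity: an orthogonal basis φ₀, φ₁, φ₂ of D with φⱼ ∧ φⱼ = cⱼ·vol consists of invertible maps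
Cⱼ : U* → U. Contracting the relations φᵢ ∧ φⱼ = δᵢⱼcᵢ·vol shows that A = C₀⁻¹C₁ and B = C₀⁻¹C₂
anticommute and have squares -c₁/c₀ and -c₂/c₀ (`exists_operators`). Such a quaternionic action on
U* brings the φⱼ to normal form up to a common scalar (`exists_basis_normalForm`), which rescaling
the generators of degree one removes.

Well-definedness: an isomorphism (a, b) ≅ (a', b') makes (a, b) act on the dual space attached to
`model a' b'`, and a basis of its D adapted to this action exists (`model_iso_of_algEquiv`).
Injectivity: an isomorphism of models carries one D to the other, and the operators C₀⁻¹Cⱼ generate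
the quaternion algebra (`algEquiv_of_quatForm`, `algEquiv_of_iso`). -/

noncomputable section

namespace TwoStepMinimal

open ExteriorAlgebra CliffordAlgebra

/-! ### Exterior algebra: signs, differentials, bivectors as alternating forms -/

section Exterior

variable {k : Type*} [Field k] {U V : Type*} [AddCommGroup U] [Module k U]
  [AddCommGroup V] [Module k V]

theorem ι_mul_ι_swap (u v : U) :
    ExteriorAlgebra.ι k u * ExteriorAlgebra.ι k v =
      -(ExteriorAlgebra.ι k v * ExteriorAlgebra.ι k u) :=
  eq_neg_of_add_eq_zero_left (ExteriorAlgebra.ι_add_mul_swap u v)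

theorem ι_mem_exteriorPower_one (u : U) : ExteriorAlgebra.ι k u ∈ ⋀[k]^1 U := by
  rw [exteriorPower, pow_one]; exact ⟨u, rfl⟩

theorem ι_mul_mem_exteriorPower {p : ℕ} (u : U) {x : ExteriorAlgebra k U} (hx : x ∈ ⋀[k]^p U) :
    ExteriorAlgebra.ι k u * x ∈ ⋀[k]^(p + 1) U := by
  rw [exteriorPower, pow_succ']
  exact Submodule.mul_mem_mul ⟨u, rfl⟩ hx

theorem ι_mul_ι_mem_exteriorPower_two (u v : U) :
    ExteriorAlgebra.ι k u * ExteriorAlgebra.ι k v ∈ ⋀[k]^2 U :=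
  ι_mul_mem_exteriorPower u (ι_mem_exteriorPower_one v)

@[elab_as_elim]
theorem exteriorPower_two_induction {C : ∀ φ, φ ∈ ⋀[k]^2 U → Prop}
    (mul : ∀ u v, C (ExteriorAlgebra.ι k u * ExteriorAlgebra.ι k v)
      (ι_mul_ι_mem_exteriorPower_two u v))
    (add : ∀ x y hx hy, C x hx → C y hy → C (x + y) (add_mem hx hy))
    {φ : ExteriorAlgebra k U} (hφ : φ ∈ ⋀[k]^2 U) : C φ hφ := by
  have hφ' := hφ
  rw [exteriorPower, pow_two] at hφ'
  obtain ⟨_, h⟩ : ∃ h, C φ h := by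
    refine Submodule.mul_induction_on hφ' ?_ fun x y ⟨hx, h⟩ ⟨hy, h'⟩ => ⟨_, add x y hx hy h h'⟩
    rintro _ ⟨u, rfl⟩ _ ⟨v, rfl⟩
    exact ⟨_, mul u v⟩
  exact h

theorem exteriorPower_induction {C : ℕ → ExteriorAlgebra k U → Prop}
    (scalar : ∀ r : k, C 0 (algebraMap k _ r))
    (add : ∀ p, ∀ x y, C p x → C p y → C p (x + y))
    (mul : ∀ p u, ∀ x ∈ ⋀[k]^p U, C p x → C (p + 1) (ExteriorAlgebra.ι k u * x))
    {p : ℕ} {x : ExteriorAlgebra k U} (hx : x ∈ ⋀[k]^p U) : C p x := by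
  refine Submodule.pow_induction_on_left' _ (C := fun p x _ => C p x) scalar
    (fun x y p _ _ => add p x y) ?_ hx
  rintro _ ⟨u, rfl⟩ p x hx h
  exact mul p u x hx h

theorem ι_mul_graded_comm (u : U) {q : ℕ} {y : ExteriorAlgebra k U} (hy : y ∈ ⋀[k]^q U) :
    ExteriorAlgebra.ι k u * y = (-1) ^ q * (y * ExteriorAlgebra.ι k u) := by
  refine exteriorPower_induction
    (C := fun q y => ExteriorAlgebra.ι k u * y = (-1) ^ q * (y * ExteriorAlgebra.ι k u))
    (fun r => ?_) (fun p x y hx hy => ?_) (fun p v x _ hx => ?_) hy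
  · rw [pow_zero, one_mul, Algebra.commutes]
  · rw [mul_add, hx, hy, add_mul, mul_add]
  · rw [← mul_assoc, ι_mul_ι_swap, neg_mul, mul_assoc, hx, pow_succ]
    have : ExteriorAlgebra.ι k v * ((-1) ^ p * (x * ExteriorAlgebra.ι k u)) =
        (-1) ^ p * (ExteriorAlgebra.ι k v * (x * ExteriorAlgebra.ι k u)) := by
      rw [← mul_assoc, ((Commute.neg_one_left (ExteriorAlgebra.ι k v)).pow_left p).eq.symm,
        mul_assoc]
    rw [this]
    simp [mul_assoc]

theorem exteriorAlgebra_graded_comm {p q : ℕ} {x y : ExteriorAlgebra k U}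
    (hx : x ∈ ⋀[k]^p U) (hy : y ∈ ⋀[k]^q U) : x * y = (-1) ^ (p * q) * (y * x) := by
  refine exteriorPower_induction (C := fun p x => x * y = (-1) ^ (p * q) * (y * x))
    (fun r => ?_) (fun p x z hx hz => ?_) (fun p v x _ hx => ?_) hx
  · rw [Nat.zero_mul, pow_zero, one_mul, Algebra.commutes]
  · rw [add_mul, hx, hz, mul_add, mul_add]
  · have hc : ExteriorAlgebra.ι k v * (-1) ^ (p * q) = (-1) ^ (p * q) * ExteriorAlgebra.ι k v :=
      ((Commute.neg_one_left (ExteriorAlgebra.ι k v)).pow_left _).eq.symm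
    rw [mul_assoc, hx, ← mul_assoc, hc, mul_assoc, ← mul_assoc (ExteriorAlgebra.ι k v),
      ι_mul_graded_comm v hy, add_mul, one_mul, pow_add]
    simp only [mul_assoc]

/-- An antiderivation of the exterior algebra that raises the degree of generators by one and
whose square vanishes on generators is a differential. -/
theorem isCDGA_of_antiderivation {k V : Type u} [Field k] [AddCommGroup V] [Module k V]
    (d : ExteriorAlgebra k V →ₗ[k] ExteriorAlgebra k V) (h1 : d 1 = 0)
    (hι : ∀ v, d (ExteriorAlgebra.ι k v) ∈ ⋀[k]^2 V)
    (hd : ∀ v, d (d (ExteriorAlgebra.ι k v)) = 0)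
    (hmul : ∀ v x, d (ExteriorAlgebra.ι k v * x) =
      d (ExteriorAlgebra.ι k v) * x - ExteriorAlgebra.ι k v * d x) :
    IsCDGA (fun p : ℕ => ⋀[k]^p V) d := by
  have hsc : ∀ r : k, d (algebraMap k _ r) = 0 := fun r => by
    rw [Algebra.algebraMap_eq_smul_one, map_smul, h1, smul_zero]
  have hleib : ∀ (p : ℕ) (x : ExteriorAlgebra k V), x ∈ ⋀[k]^p V → ∀ y,
      d (x * y) = d x * y + (-1) ^ p * (x * d y) := by
    intro p x hx
    refine exteriorPower_induction
      (C := fun p x => ∀ y, d (x * y) = d x * y + (-1) ^ p * (x * d y))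
      (fun r y => ?_) (fun p x z hx hz y => ?_) (fun p v x _ hx y => ?_) hx
    · rw [hsc, ← Algebra.smul_def, map_smul, zero_mul, zero_add, pow_zero, one_mul,
        Algebra.smul_def]
    · rw [add_mul, map_add, hx, hz, map_add, add_mul, add_mul, mul_add]; abel
    · have hc : ExteriorAlgebra.ι k v * (-1) ^ p = (-1) ^ p * ExteriorAlgebra.ι k v :=
        ((Commute.neg_one_left (ExteriorAlgebra.ι k v)).pow_left _).eq.symm
      rw [mul_assoc, hmul, hx, hmul, mul_add, ← mul_assoc _ ((-1) ^ p), hc, pow_succ]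
      simp only [mul_assoc, sub_mul, neg_mul, one_mul, mul_neg]
      abel
  refine ⟨fun p q x hx y hy => exteriorAlgebra_graded_comm hx hy, fun p x hx => ?_, fun x => ?_,
    fun p q x hx y _ => hleib p x hx y⟩
  · refine exteriorPower_induction (C := fun p x => d x ∈ ⋀[k]^(p + 1) V)
      (fun r => ?_) (fun p x z hx hz => ?_) (fun p v x hx h => ?_) hx
    · rw [hsc]; exact zero_mem _
    · rw [map_add]; exact add_mem hx hz
    · rw [hmul]
      refine sub_mem ?_ (ι_mul_mem_exteriorPower v h)
      have := SetLike.mul_mem_graded (A := fun i : ℕ => ⋀[k]^i V) (hι v) hx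
      rwa [show p + 1 + 1 = 2 + p by ring]
  · induction x using CliffordAlgebra.left_induction with
    | algebraMap r => rw [hsc, map_zero]
    | add x y hx hy => rw [map_add, map_add, hx, hy, add_zero]
    | ι_mul v x hx =>
      -- The two cross terms d(v)·d(x) cancel, since d(v) has even degree and v odd degree.
      rw [hmul, map_sub, hleib 2 _ (hι _), hd, hmul, hx]
      simp

theorem IsCDGA.map_ι_mul {k V : Type u} [Field k] [AddCommGroup V] [Module k V]
    {d : ExteriorAlgebra k V →ₗ[k] ExteriorAlgebra k V} (h : IsCDGA (fun p : ℕ => ⋀[k]^p V) d)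
    (v : V) (x : ExteriorAlgebra k V) : d (ExteriorAlgebra.ι k v * x) =
      d (ExteriorAlgebra.ι k v) * x - ExteriorAlgebra.ι k v * d x := by
  induction x using DirectSum.Decomposition.inductionOn (fun p : ℕ => ⋀[k]^p V) with
  | zero => simp
  | homogeneous m =>
    rw [h.leibniz 1 _ _ (ι_mem_exteriorPower_one v) _ m.2, pow_one, neg_one_mul, sub_eq_add_neg]
  | add x y hx hy => rw [mul_add, map_add, hx, hy, map_add, mul_add, mul_add]; abel

theorem IsCDGA.map_algebraMap {k V : Type u} [Field k] [AddCommGroup V] [Module k V]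
    {d : ExteriorAlgebra k V →ₗ[k] ExteriorAlgebra k V} (h : IsCDGA (fun p : ℕ => ⋀[k]^p V) d)
    (r : k) : d (algebraMap k _ r) = 0 := by
  have h1 : (1 : ExteriorAlgebra k V) ∈ ⋀[k]^0 V := by
    rw [exteriorPower, pow_zero]; exact Submodule.one_le.mp le_rfl
  have := h.leibniz 0 0 1 h1 1 h1
  rw [Algebra.algebraMap_eq_smul_one, map_smul]
  simp at this
  rw [this, smul_zero]

/-- The bilinear form on the dual space defined by a bivector. -/
def bform (φ : ExteriorAlgebra k U) : Module.Dual k U →ₗ[k] Module.Dual k U →ₗ[k] k :=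
  LinearMap.mk₂ k
    (fun α β => algebraMapInv (contractLeft (Q := (0 : QuadraticForm k U)) β
      (contractLeft (Q := (0 : QuadraticForm k U)) α φ)))
    (by intros; simp) (by intros; simp) (by intros; simp) (by intros; simp)

theorem bform_apply (φ : ExteriorAlgebra k U) (α β : Module.Dual k U) :
    bform φ α β = algebraMapInv (contractLeft (Q := (0 : QuadraticForm k U)) β
      (contractLeft (Q := (0 : QuadraticForm k U)) α φ)) := rfl

@[simp] theorem bform_add (φ ψ : ExteriorAlgebra k U) : bform (φ + ψ) = bform φ + bform ψ := by
  ext; simp [bform_apply]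

@[simp] theorem bform_zero : bform (0 : ExteriorAlgebra k U) = 0 := by
  ext; simp [bform_apply]

@[simp] theorem bform_neg (φ : ExteriorAlgebra k U) : bform (-φ) = -bform φ := by
  ext; simp [bform_apply]

@[simp] theorem bform_smul (c : k) (φ : ExteriorAlgebra k U) : bform (c • φ) = c • bform φ := by
  ext; simp [bform_apply]

@[simp] theorem bform_ι_mul_ι (u v : U) (α β : Module.Dual k U) :
    bform (ExteriorAlgebra.ι k u * ExteriorAlgebra.ι k v) α β = α u * β v - α v * β u := by
  simp [bform_apply, contractLeft_ι_mul, algebraMapInv, Algebra.smul_def,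
    CliffordAlgebra.contractLeft_algebraMap_mul, CliffordAlgebra.contractLeft_mul_algebraMap,
    mul_comm]

theorem bform_self (φ : ExteriorAlgebra k U) (α : Module.Dual k U) : bform φ α α = 0 := by
  rw [bform_apply, contractLeft_contractLeft, map_zero]

theorem bform_swap (φ : ExteriorAlgebra k U) (α β : Module.Dual k U) :
    bform φ α β = -bform φ β α := by
  rw [bform_apply, bform_apply, contractLeft_comm, map_neg]

theorem bform_map (F : U →ₗ[k] V) {φ : ExteriorAlgebra k U} (hφ : φ ∈ ⋀[k]^2 U)
    (α β : Module.Dual k V) :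
    bform (ExteriorAlgebra.map F φ) α β = bform φ (α ∘ₗ F) (β ∘ₗ F) := by
  induction hφ using exteriorPower_two_induction with
  | mul u v => simp
  | add x y _ _ hx hy => simp [hx, hy]

/-- A bivector is determined by its bilinear form. -/
theorem two_smul_bivector_eq {n : Type*} [Fintype n] (b : Module.Basis n k U)
    {φ : ExteriorAlgebra k U} (hφ : φ ∈ ⋀[k]^2 U) :
    (2 : k) • φ = ∑ i, ∑ j, bform φ (b.coord i) (b.coord j) •
      (ExteriorAlgebra.ι k (b i) * ExteriorAlgebra.ι k (b j)) := by
  induction hφ using exteriorPower_two_induction with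
  | mul u v =>
    have key : ∀ u v : U, ∑ i, ∑ j, (b.coord i u * b.coord j v) •
        (ExteriorAlgebra.ι k (b i) * ExteriorAlgebra.ι k (b j)) =
        ExteriorAlgebra.ι k u * ExteriorAlgebra.ι k v := by
      intro u v
      conv_rhs => rw [← b.sum_repr u, ← b.sum_repr v]
      simp only [map_sum, map_smul, Finset.sum_mul_sum, smul_mul_smul_comm, Module.Basis.coord_apply]
    simp only [bform_ι_mul_ι, sub_smul, Finset.sum_sub_distrib, key]
    rw [ι_mul_ι_swap v u, two_smul, sub_neg_eq_add]
  | add x y _ _ hx hy => simp only [smul_add, hx, hy, bform_add, LinearMap.add_apply, add_smul,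
      Finset.sum_add_distrib]

/-- The contraction of a bivector has degree one, so projecting to U by `ιInv` loses nothing. -/
theorem ι_ιInv_contractLeft (α : Module.Dual k U) {φ : ExteriorAlgebra k U} (hφ : φ ∈ ⋀[k]^2 U) :
    ExteriorAlgebra.ι k (ιInv (contractLeft (Q := (0 : QuadraticForm k U)) α φ)) =
      contractLeft (Q := (0 : QuadraticForm k U)) α φ := by
  induction hφ using exteriorPower_two_induction with
  | mul u v =>
    have : contractLeft (Q := (0 : QuadraticForm k U)) α
        (ExteriorAlgebra.ι k u * ExteriorAlgebra.ι k v) =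
        ExteriorAlgebra.ι k (α u • v - α v • u) := by
      rw [contractLeft_ι_mul, contractLeft_ι, ← Algebra.commutes, ← Algebra.smul_def, map_sub,
        map_smul, map_smul]
    rw [this, ι_leftInverse]
  | add x y _ _ hx hy => simp only [map_add, hx, hy]

/-- Contraction is an antiderivation; the sign disappears because φ has even degree. -/
theorem contractLeft_bivector_mul (α : Module.Dual k U) {φ : ExteriorAlgebra k U}
    (hφ : φ ∈ ⋀[k]^2 U) (x : ExteriorAlgebra k U) :
    contractLeft (Q := (0 : QuadraticForm k U)) α (φ * x) =
      contractLeft (Q := (0 : QuadraticForm k U)) α φ * x +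
        φ * contractLeft (Q := (0 : QuadraticForm k U)) α x := by
  induction hφ using exteriorPower_two_induction with
  | mul u v =>
    simp only [mul_assoc, contractLeft_ι_mul, contractLeft_ι, mul_sub, sub_mul, smul_mul_assoc,
      mul_smul_comm, Algebra.algebraMap_eq_smul_one, mul_one]
    abel
  | add x y _ _ hx hy => simp only [add_mul, map_add, hx, hy]; abel

theorem bivector_comm {φ : ExteriorAlgebra k U} (hφ : φ ∈ ⋀[k]^2 U) (u : U) :
    ExteriorAlgebra.ι k u * φ = φ * ExteriorAlgebra.ι k u := by
  rw [ι_mul_graded_comm u hφ]; simp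

end Exterior

/-! ### Normal form of three bivectors in dimension four -/

section NormalForm

variable {k : Type*} [Field k] {U V : Type*} [AddCommGroup U] [Module k U]
  [AddCommGroup V] [Module k V]

/-- The three bivectors `e₀e₃ + e₁e₂`, `e₀e₂ + a e₁e₃`, `b e₂e₃ - e₀e₁`. -/
def normalForm {A : Type*} [Ring A] [Algebra k A] (a b : k) (e : Fin 4 → A) : Fin 3 → A :=
  ![e 0 * e 3 + e 1 * e 2, e 0 * e 2 + a • (e 1 * e 3), b • (e 2 * e 3) - e 0 * e 1]

theorem map_normalForm {A B : Type*} [Ring A] [Algebra k A] [Ring B] [Algebra k B]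
    (f : A →ₐ[k] B) (a b : k) (e : Fin 4 → A) (j : Fin 3) :
    f (normalForm a b e j) = normalForm a b (fun i => f (e i)) j := by
  fin_cases j <;> simp [normalForm]

theorem normalForm_mem {a b : k} (e : Fin 4 → U) (j : Fin 3) :
    normalForm a b (fun i => ExteriorAlgebra.ι k (e i)) j ∈ ⋀[k]^2 U := by
  have h := fun i l => ι_mul_ι_mem_exteriorPower_two (k := k) (e i) (e l)
  fin_cases j
  · exact add_mem (h 0 3) (h 1 2)
  · exact add_mem (h 0 2) (Submodule.smul_mem _ _ (h 1 3))
  · exact sub_mem (Submodule.smul_mem _ _ (h 2 3)) (h 0 1)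

/-- The alternating form on a quaternion algebra that is proportional to `re (ij * x * star y)`. -/
def quatForm {a b : k} (x y : ℍ[k, a, b]) : k :=
  x.re * y.imK + x.imI * y.imJ - x.imJ * y.imI - x.imK * y.re

/-- The dictionary between bivectors and quaternions: the three normal forms correspond to left
multiplication by 1, i and j, followed by one fixed alternating form. -/
theorem bform_normalForm (a b : k) (e : Fin 4 → U) (y : Fin 3 → k) (α β : Module.Dual k U) :
    bform (∑ j, y j • normalForm a b (fun i => ExteriorAlgebra.ι k (e i)) j) α β =
      quatForm ((⟨y 0, y 1, y 2, 0⟩ : ℍ[k, a, b]) * ⟨α (e 0), α (e 1), α (e 2), α (e 3)⟩)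
        ⟨β (e 0), β (e 1), β (e 2), β (e 3)⟩ := by
  simp [Fin.sum_univ_three, normalForm, quatForm, sub_eq_add_neg]
  ring

theorem exists_dual_family {e : Fin 4 → U} (he : LinearIndependent k e) :
    ∃ α : Fin 4 → Module.Dual k U, ∀ i j, α i (e j) = if i = j then 1 else 0 := by
  obtain ⟨G, hG⟩ := LinearMap.exists_leftInverse_of_injective (Fintype.linearCombination k e)
    (LinearMap.ker_eq_bot.mpr (he.fintypeLinearCombination_injective))
  refine ⟨fun i => LinearMap.proj i ∘ₗ G, fun i j => ?_⟩
  have := LinearMap.congr_fun hG (Pi.single j 1)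
  simp only [LinearMap.comp_apply, Fintype.linearCombination_apply_single, one_smul,
    LinearMap.id_apply] at this
  rw [LinearMap.comp_apply, this, LinearMap.proj_apply, Pi.single_apply]

theorem normalForm_linearIndependent (a b : k) {e : Fin 4 → U} (he : LinearIndependent k e) :
    LinearIndependent k (normalForm a b (fun i => ExteriorAlgebra.ι k (e i))) := by
  obtain ⟨α, hα⟩ := exists_dual_family he
  rw [Fintype.linearIndependent_iff]
  intro y hy
  have h := fun i j => bform_normalForm a b e y (α i) (α j)
  simp only [hy, bform_zero, LinearMap.zero_apply, hα] at h
  have h1 := h 0 1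
  have h2 := h 0 2
  have h3 := h 0 3
  simp [quatForm] at h1 h2 h3
  intro j
  fin_cases j <;> simp_all

/-- Two anticommuting operators with nonzero scalar squares that relate three bivectors in
dimension four bring these bivectors to normal form. -/
theorem exists_basis_normalForm {X : Type*} [AddCommGroup X] [Module k X] (h2 : (2 : k) ≠ 0)
    (hU : Module.finrank k U = 4) (τ : X ≃ₗ[k] Module.Dual k U) {a b : k} (ha : a ≠ 0) (hb : b ≠ 0)
    (A B : X →ₗ[k] X) (hA : ∀ x, A (A x) = a • x) (hB : ∀ x, B (B x) = b • x)
    (hAB : ∀ x, A (B x) = -B (A x)) (φ : Fin 3 → ExteriorAlgebra k U) (hφ : ∀ j, φ j ∈ ⋀[k]^2 U)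
    (hφA : ∀ x y, bform (φ 1) (τ x) (τ y) = bform (φ 0) (τ (A x)) (τ y))
    (hφB : ∀ x y, bform (φ 2) (τ x) (τ y) = bform (φ 0) (τ (B x)) (τ y))
    (hnd : ∀ x, (∀ y, bform (φ 0) (τ x) (τ y) = 0) → x = 0) :
    ∃ (e : Module.Basis (Fin 4) k U) (t : k), t ≠ 0 ∧
      ∀ j, φ j = t • normalForm a b (fun i => ExteriorAlgebra.ι k (e i)) j := by
  have : FiniteDimensional k U := Module.finite_of_finrank_pos (by omega)
  have : FiniteDimensional k X := Module.Finite.equiv τ.symm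
  have hX : Module.finrank k X = 4 := by rw [τ.finrank_eq, Subspace.dual_finrank_eq, hU]
  set ω : X → X → k := fun x y => bform (φ 0) (τ x) (τ y) with hω
  have sw : ∀ x y, ω x y = -ω y x := fun x y => bform_swap _ _ _
  have add_r : ∀ x y z, ω x (y + z) = ω x y + ω x z := fun x y z => by simp [hω]
  have add_l : ∀ x y z, ω (x + y) z = ω x z + ω y z := fun x y z => by simp [hω]
  have smul_r : ∀ (c : k) x y, ω x (c • y) = c * ω x y := fun c x y => by simp [hω]
  have smul_l : ∀ (c : k) x y, ω (c • x) y = c * ω x y := fun c x y => by simp [hω]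
  have neg_l : ∀ x y, ω (-x) y = -ω x y := fun x y => by simp [hω]
  have self : ∀ x, ω x x = 0 := fun x => bform_self _ _
  have formA : ∀ x y, ω (A x) y = bform (φ 1) (τ x) (τ y) := fun x y => (hφA x y).symm
  have formB : ∀ x y, ω (B x) y = bform (φ 2) (τ x) (τ y) := fun x y => (hφB x y).symm
  have adjA : ∀ x y, ω (A x) y = ω x (A y) := fun x y => by
    rw [sw x, formA, formA, bform_swap]
  have adjB : ∀ x y, ω (B x) y = ω x (B y) := fun x y => by
    rw [sw x, formB, formB, bform_swap]
  have selfA : ∀ x, ω x (A x) = 0 := fun x => by rw [← adjA, formA, bform_self]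
  have selfB : ∀ x, ω x (B x) = 0 := fun x => by rw [← adjB, formB, bform_self]
  -- The form (x, y) ↦ ω(x, ABy) is symmetric, because A and B are self-adjoint for ω and
  -- anticommute. If its diagonal vanished it would be zero, as 2 ≠ 0, against nondegeneracy of ω
  -- and invertibility of AB.
  obtain ⟨v, hv⟩ : ∃ v, ω v (A (B v)) ≠ 0 := by
    by_contra! h
    have sym : ∀ x y, ω y (A (B x)) = ω x (A (B y)) := fun x y => by
      rw [← adjA, ← adjB, ← neg_neg (B (A y)), ← hAB, neg_l, sw, neg_neg]
    have zero : ∀ x y, ω x (A (B y)) = 0 := fun x y => by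
      have := h (x + y)
      rw [map_add, map_add, add_r, add_l, add_l, h, h, sym x y] at this
      have : 2 * ω x (A (B y)) = 0 := by linear_combination this
      exact (mul_eq_zero.mp this).resolve_left h2
    have triv : ∀ y : X, y = 0 := fun y => by
      have h0 : A (B y) = 0 := hnd _ fun x => by
        change ω _ _ = 0
        rw [sw, zero, neg_zero]
      have h1 : B y = 0 := by
        have := hA (B y)
        rw [h0, map_zero] at this
        exact (smul_eq_zero.mp this.symm).resolve_left ha
      have := hB y
      rw [h1, map_zero] at this
      exact (smul_eq_zero.mp this.symm).resolve_left hb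
    have : Subsingleton X := ⟨fun x y => by rw [triv x, triv y]⟩
    rw [Module.finrank_zero_of_subsingleton] at hX
    omega
  -- The Gram matrix of ω on v, Av, Bv, ABv is antidiagonal with entries ±t. This gives both the
  -- linear independence of these vectors and the shape t(e₀e₃ + e₁e₂) of the first bivector.
  set t := ω v (A (B v)) with ht
  have t12 : ω (A v) (B v) = t := adjA _ _
  have t13 : ω (A v) (A (B v)) = 0 := by rw [adjA, hA, smul_r, selfB, mul_zero]
  have t23 : ω (B v) (A (B v)) = 0 := by rw [selfA]
  have t01 := selfA v
  have t02 := selfB v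
  have s10 : ω (A v) v = 0 := by rw [sw, t01, neg_zero]
  have s20 : ω (B v) v = 0 := by rw [sw, t02, neg_zero]
  have s30 : ω (A (B v)) v = -t := by rw [sw]
  have s21 : ω (B v) (A v) = -t := by rw [sw, t12]
  have s31 : ω (A (B v)) (A v) = 0 := by rw [sw, t13, neg_zero]
  have s32 : ω (A (B v)) (B v) = 0 := by rw [sw, t23, neg_zero]
  have hBA : B (A v) = -A (B v) := by rw [hAB, neg_neg]
  have hBAB : B (A (B v)) = -(b • A v) := by rw [← neg_neg (B (A (B v))), ← hAB, hB, map_smul]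
  set w : Fin 4 → X := ![v, A v, B v, A (B v)] with hw
  have hli : LinearIndependent k w := by
    rw [Fintype.linearIndependent_iff]
    intro c hc
    have hc' : c 0 • v + c 1 • A v + c 2 • B v + c 3 • A (B v) = 0 := by
      simpa [Fin.sum_univ_four, hw] using hc
    have key : ∀ y, c 0 * ω v y + c 1 * ω (A v) y + c 2 * ω (B v) y + c 3 * ω (A (B v)) y = 0 := by
      intro y
      rw [← smul_l, ← smul_l, ← smul_l, ← smul_l, ← add_l, ← add_l, ← add_l, hc']
      simp [hω]
    have k0 := key v
    have k1 := key (A v)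
    have k2 := key (B v)
    have k3 := key (A (B v))
    rw [self, s10, s20, s30] at k0
    rw [self, t01, s21, s31] at k1
    rw [self, t02, t12, s32] at k2
    rw [self, ← ht, t13, t23] at k3
    simp [hv] at k0 k1 k2 k3
    intro i
    fin_cases i <;> assumption
  set bX := basisOfLinearIndependentOfCardEqFinrank hli (by simp [hX]) with hbX
  -- The required basis e of U is the one whose coordinate functionals are the images under τ of v,
  -- Av, Bv, ABv.
  set L : U →ₗ[k] (Fin 4 → k) := LinearMap.pi fun i => τ (w i) with hL
  have hLinj : Function.Injective L := by
    rw [← LinearMap.ker_eq_bot, LinearMap.ker_eq_bot']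
    intro u hu
    rw [← Module.forall_dual_apply_eq_zero_iff k]
    intro α
    obtain ⟨x, rfl⟩ := τ.surjective α
    have hwu : ∀ i, τ (w i) u = 0 := fun i => congrFun hu i
    rw [← bX.sum_repr x]
    simp [hbX, hwu]
  set e := Module.Basis.ofEquivFun (L.linearEquivOfInjective hLinj (by simp [hU])) with he
  have hcoord : ∀ i, e.coord i = τ (w i) := by
    intro i
    ext u
    simp [he, hL]
  refine ⟨e, t, hv, ?_⟩
  have w0 : w 0 = v := rfl
  have w1 : w 1 = A v := rfl
  have w2 : w 2 = B v := rfl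
  have w3 : w 3 = A (B v) := rfl
  -- The expansion of a bivector over all ordered pairs counts each term twice, so the identities
  -- are compared after doubling.
  have cancel : ∀ x y : ExteriorAlgebra k U, (2 : k) • x = (2 : k) • y → x = y :=
    fun x y h => smul_right_injective _ h2 h
  have swp := fun i j => ι_mul_ι_swap (k := k) (e i) (e j)
  have sq := fun i => ExteriorAlgebra.ι_sq_zero (R := k) (e i)
  have hω' : ∀ x y, bform (φ 0) (τ x) (τ y) = ω x y := fun _ _ => rfl
  intro j
  apply cancel
  rw [two_smul_bivector_eq e (hφ j)]
  simp only [hcoord, Fin.sum_univ_four, w0, w1, w2, w3, sq, smul_zero, swp 1 0, swp 2 0, swp 3 0,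
    swp 2 1, swp 3 1, swp 3 2]
  fin_cases j
  · simp only [Fin.zero_eta, Fin.isValue, hω', s10, s20, s30, t01, t02, t12, t13, t23, s21, s31,
      s32, ← ht]
    simp only [normalForm, Matrix.cons_val]
    module
  · simp only [Fin.mk_one, Fin.isValue, hφA, hω', hA, smul_l, self, s20, s30, t02, t12,
      t13, s21, s31, ← ht]
    simp only [normalForm, Matrix.cons_val]
    module
  · simp only [Fin.reduceFinMk, Fin.isValue, hφB, hω', hB, hBA, hBAB, smul_l, neg_l, self, s10,
      s30, t01, t12, t23, s21, s32, ← ht]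
    simp only [normalForm, Matrix.cons_val]
    module

end NormalForm

/-! ### Isomorphisms induced by linear maps of generators -/

section Iso

variable {k : Type u} [Field k]

theorem map_mem_exteriorPower {U V : Type*} [AddCommGroup U] [Module k U] [AddCommGroup V]
    [Module k V] (F : U →ₗ[k] V) {p : ℕ} {x : ExteriorAlgebra k U} (hx : x ∈ ⋀[k]^p U) :
    ExteriorAlgebra.map F x ∈ ⋀[k]^p V := by
  refine exteriorPower_induction (C := fun p x => ExteriorAlgebra.map F x ∈ ⋀[k]^p V)
    (fun r => ?_) (fun p x z hx hz => ?_) (fun p v x _ hx => ?_) hx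
  · rw [AlgHom.commutes, exteriorPower, pow_zero]; exact Submodule.algebraMap_mem r
  · rw [map_add]; exact add_mem hx hz
  · rw [map_mul, ExteriorAlgebra.map_apply_ι]; exact ι_mul_mem_exteriorPower _ hx

theorem MinimalAlgebra.map_d_of_ι {M N : MinimalAlgebra k} (F : M.V →ₗ[k] N.V)
    (h : ∀ v, ExteriorAlgebra.map F (M.d (ExteriorAlgebra.ι k v)) =
      N.d (ExteriorAlgebra.ι k (F v))) (x : ExteriorAlgebra k M.V) :
    ExteriorAlgebra.map F (M.d x) = N.d (ExteriorAlgebra.map F x) := by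
  induction x using CliffordAlgebra.left_induction with
  | algebraMap r => rw [M.isCDGA.map_algebraMap, AlgHom.commutes, N.isCDGA.map_algebraMap, map_zero]
  | add x y hx hy => rw [map_add, map_add, hx, hy, map_add, map_add]
  | ι_mul x v hx =>
    have e : ExteriorAlgebra.map F (CliffordAlgebra.ι 0 v) = ExteriorAlgebra.ι k (F v) :=
      ExteriorAlgebra.map_apply_ι F v
    rw [M.isCDGA.map_ι_mul, map_sub, map_mul, map_mul, h, hx, map_mul, e, N.isCDGA.map_ι_mul]

theorem MinimalAlgebra.iso_of_linearEquiv {M N : MinimalAlgebra k} (F : M.V ≃ₗ[k] N.V)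
    (h : ∀ v, ExteriorAlgebra.map F.toLinearMap (M.d (ExteriorAlgebra.ι k v)) =
      N.d (ExteriorAlgebra.ι k (F v))) : M.Iso N := by
  have h1 : (ExteriorAlgebra.map F.toLinearMap).comp
      (ExteriorAlgebra.map F.symm.toLinearMap) = AlgHom.id k _ := by
    rw [ExteriorAlgebra.map_comp_map, LinearEquiv.comp_symm, ExteriorAlgebra.map_id]
  have h2 : (ExteriorAlgebra.map F.symm.toLinearMap).comp
      (ExteriorAlgebra.map F.toLinearMap) = AlgHom.id k _ := by
    rw [ExteriorAlgebra.map_comp_map, LinearEquiv.symm_comp, ExteriorAlgebra.map_id]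
  refine ⟨AlgEquiv.ofAlgHom _ _ h1 h2, fun p x => ⟨fun hx => ?_, map_mem_exteriorPower _⟩,
    fun x => map_d_of_ι F.toLinearMap h x⟩
  have := map_mem_exteriorPower F.symm.toLinearMap hx
  rwa [AlgEquiv.ofAlgHom_apply, ← AlgHom.comp_apply, h2] at this

end Iso

/-! ### The model algebras and criteria for being isomorphic to one -/

section Model

variable {k : Type u} [Field k]

/-- The `i`-th closed generator of the model algebra. -/
def modelGen (k : Type u) [Field k] (i : Fin 4) : (Fin 4 → k) × (Fin 3 → k) :=
  (Pi.single i 1, 0)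

/-- The differential for which the generators of `k³` are mapped to `normalForm a b` in the
generators of `k⁴`. -/
def modelD (a b : k) : ExteriorAlgebra k ((Fin 4 → k) × (Fin 3 → k)) →ₗ[k]
    ExteriorAlgebra k ((Fin 4 → k) × (Fin 3 → k)) :=
  ∑ j, LinearMap.mulLeft k (normalForm a b (fun i => ExteriorAlgebra.ι k (modelGen k i)) j) ∘ₗ
    contractLeft (Q := (0 : QuadraticForm k ((Fin 4 → k) × (Fin 3 → k))))
      (LinearMap.proj j ∘ₗ LinearMap.snd k (Fin 4 → k) (Fin 3 → k))

theorem modelD_apply (a b : k) (x : ExteriorAlgebra k ((Fin 4 → k) × (Fin 3 → k))) :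
    modelD a b x = ∑ j, normalForm a b (fun i => ExteriorAlgebra.ι k (modelGen k i)) j *
      contractLeft (Q := (0 : QuadraticForm k ((Fin 4 → k) × (Fin 3 → k))))
        (LinearMap.proj j ∘ₗ LinearMap.snd k (Fin 4 → k) (Fin 3 → k)) x := by
  simp [modelD]

theorem modelD_ι (a b : k) (v : (Fin 4 → k) × (Fin 3 → k)) :
    modelD a b (ExteriorAlgebra.ι k v) =
      ∑ j, v.2 j • normalForm a b (fun i => ExteriorAlgebra.ι k (modelGen k i)) j := by
  rw [modelD_apply]
  refine Finset.sum_congr rfl fun j _ => ?_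
  rw [contractLeft_ι, ← Algebra.commutes, ← Algebra.smul_def]
  rfl

theorem modelD_ι_mul (a b : k) (v : (Fin 4 → k) × (Fin 3 → k))
    (x : ExteriorAlgebra k ((Fin 4 → k) × (Fin 3 → k))) :
    modelD a b (ExteriorAlgebra.ι k v * x) =
      modelD a b (ExteriorAlgebra.ι k v) * x - ExteriorAlgebra.ι k v * modelD a b x := by
  rw [modelD_ι, modelD_apply, modelD_apply, Finset.sum_mul, Finset.mul_sum,
    ← Finset.sum_sub_distrib]
  refine Finset.sum_congr rfl fun j _ => ?_
  rw [contractLeft_ι_mul, mul_sub, ← mul_assoc, ← bivector_comm (normalForm_mem _ j), mul_smul_comm,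
    smul_mul_assoc, mul_assoc]
  rfl

theorem modelD_modelGen (a b : k) (i : Fin 4) :
    modelD a b (ExteriorAlgebra.ι k (modelGen k i)) = 0 := by
  simp [modelD_ι, modelGen]

theorem modelD_normalForm (a b : k) (j : Fin 3) :
    modelD a b (normalForm a b (fun i => ExteriorAlgebra.ι k (modelGen k i)) j) = 0 := by
  have h : ∀ i l, modelD a b
      (ExteriorAlgebra.ι k (modelGen k i) * ExteriorAlgebra.ι k (modelGen k l)) = 0 := by
    intro i l
    rw [modelD_ι_mul, modelD_modelGen, modelD_modelGen, zero_mul, mul_zero, sub_zero]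
  fin_cases j <;> simp [normalForm, h]

theorem modelD_isCDGA (a b : k) :
    IsCDGA (fun p : ℕ => ⋀[k]^p ((Fin 4 → k) × (Fin 3 → k))) (modelD a b) := by
  refine isCDGA_of_antiderivation _ ?_ (fun v => ?_) (fun v => ?_) (modelD_ι_mul a b)
  · simp [modelD_apply]
  · rw [modelD_ι]
    exact sum_mem fun j _ => Submodule.smul_mem _ _ (normalForm_mem _ j)
  · rw [modelD_ι, map_sum]
    exact Finset.sum_eq_zero fun j _ => by rw [map_smul, modelD_normalForm, smul_zero]

/-- The minimal algebra generated by `e₀, …, e₃` and `w₀, w₁, w₂` with `d eᵢ = 0` and `d wⱼ` the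
`j`-th element of `normalForm a b e`. -/
def model (a b : k) : MinimalAlgebra k where
  V := (Fin 4 → k) × (Fin 3 → k)
  d := modelD a b
  isCDGA := modelD_isCDGA a b
  minimal := by
    -- The lexicographic sum places the closed generators before the others; the lift puts the index
    -- set into the universe of k.
    refine ⟨ULift.{u} (Fin 4 ⊕ₗ Fin 3), inferInstance, inferInstance,
      ((Pi.basisFun k (Fin 4)).prod (Pi.basisFun k (Fin 3))).reindex
        (toLex.trans Equiv.ulift.symm), ?_⟩
    rintro ⟨τ⟩
    obtain ⟨τ, rfl⟩ := toLex.surjective τ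
    rcases τ with i | j
    · have h : modelD a b (ExteriorAlgebra.ι k (modelGen k i)) = 0 := modelD_modelGen a b i
      simp only [modelGen] at h
      simp [h, zero_mem]
    · have hgen : ∀ i, ExteriorAlgebra.ι k (modelGen k i) ∈
          Algebra.adjoin k ((fun μ => ExteriorAlgebra.ι k
            ((((Pi.basisFun k (Fin 4)).prod (Pi.basisFun k (Fin 3))).reindex
              (toLex.trans Equiv.ulift.symm)) μ)) ''
                Set.Iio (⟨toLex (Sum.inr j)⟩ : ULift.{u} (Fin 4 ⊕ₗ Fin 3))) := by
        intro i
        refine Algebra.subset_adjoin ⟨⟨toLex (Sum.inl i)⟩, ?_, ?_⟩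
        · exact Sum.Lex.inl_lt_inr i j
        · simp [modelGen]
      rw [modelD_ι]
      refine sum_mem fun l _ => Subalgebra.smul_mem _ ?_ _
      fin_cases l
      · exact add_mem (mul_mem (hgen 0) (hgen 3)) (mul_mem (hgen 1) (hgen 2))
      · exact add_mem (mul_mem (hgen 0) (hgen 2))
          (Subalgebra.smul_mem _ (mul_mem (hgen 1) (hgen 3)) _)
      · exact sub_mem (Subalgebra.smul_mem _ (mul_mem (hgen 2) (hgen 3)) _)
          (mul_mem (hgen 0) (hgen 1))

/-- Only the eᵢ need be independent: the normal forms are then independent too, so applying d to a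
relation kills the coefficients of the wⱼ first. The dimension count does the rest. -/
theorem model_iso_of_normalForm {a b : k} (M : MinimalAlgebra k) (hM : Module.finrank k M.V = 7)
    {e : Fin 4 → M.V} (he : LinearIndependent k e)
    (hde : ∀ i, M.d (ExteriorAlgebra.ι k (e i)) = 0) {w : Fin 3 → M.V}
    (hdw : ∀ j, M.d (ExteriorAlgebra.ι k (w j)) =
      normalForm a b (fun i => ExteriorAlgebra.ι k (e i)) j) : (model a b).Iso M := by
  have : FiniteDimensional k M.V := Module.finite_of_finrank_pos (by omega)
  set F : (Fin 4 → k) × (Fin 3 → k) →ₗ[k] M.V :=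
    (Fintype.linearCombination k e).coprod (Fintype.linearCombination k w) with hF
  have hdF : ∀ v, M.d (ExteriorAlgebra.ι k (F v)) =
      ∑ j, v.2 j • normalForm a b (fun i => ExteriorAlgebra.ι k (e i)) j := by
    intro v
    simp [hF, Fintype.linearCombination_apply, hde, hdw]
  have hinj : Function.Injective F := by
    rw [← LinearMap.ker_eq_bot, LinearMap.ker_eq_bot']
    rintro ⟨x, y⟩ hv
    have h := hdF (x, y)
    rw [hv, map_zero, map_zero] at h
    have hy : y = 0 := funext <|
      Fintype.linearIndependent_iff.mp (normalForm_linearIndependent a b he) y h.symm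
    subst hy
    have hx : x = 0 := by
      apply he.fintypeLinearCombination_injective
      simpa [hF] using hv
    rw [hx]; rfl
  have hge : ∀ i, F (modelGen k i) = e i := by
    intro i
    simp [hF, modelGen]
  suffices key : ∀ v, ExteriorAlgebra.map F (modelD a b (ExteriorAlgebra.ι k v)) =
      M.d (ExteriorAlgebra.ι k (F v)) from
    MinimalAlgebra.iso_of_linearEquiv (M := model a b)
      (F.linearEquivOfInjective hinj (by simp [hM])) key
  intro v
  rw [modelD_ι, hdF, map_sum]
  refine Finset.sum_congr rfl fun j _ => ?_
  rw [map_smul, map_normalForm]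
  simp only [ExteriorAlgebra.map_apply_ι, hge]

/-- Common source of surjectivity and well-definedness. The space X is kept abstract because it is
the dual space itself in the first use and a quaternion algebra in the second. -/
theorem model_iso_of_operators {U X : Type*} [AddCommGroup U] [Module k U] [AddCommGroup X]
    [Module k X] (h2 : (2 : k) ≠ 0) {a b : k} (ha : a ≠ 0) (hb : b ≠ 0) (M : MinimalAlgebra k)
    (hM : Module.finrank k M.V = 7) (hU : Module.finrank k U = 4) (s : U →ₗ[k] M.V)
    (hs : Function.Injective s) (hds : ∀ u, M.d (ExteriorAlgebra.ι k (s u)) = 0)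
    (τ : X ≃ₗ[k] Module.Dual k U)
    (A B : X →ₗ[k] X) (hA : ∀ x, A (A x) = a • x) (hB : ∀ x, B (B x) = b • x)
    (hAB : ∀ x, A (B x) = -B (A x)) (φ : Fin 3 → ExteriorAlgebra k U) (hφ : ∀ j, φ j ∈ ⋀[k]^2 U)
    (hφA : ∀ x y, bform (φ 1) (τ x) (τ y) = bform (φ 0) (τ (A x)) (τ y))
    (hφB : ∀ x y, bform (φ 2) (τ x) (τ y) = bform (φ 0) (τ (B x)) (τ y))
    (hnd : ∀ x, (∀ y, bform (φ 0) (τ x) (τ y) = 0) → x = 0)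
    (hd : ∀ j, ∃ v, M.d (ExteriorAlgebra.ι k v) = ExteriorAlgebra.map s (φ j)) :
    (model a b).Iso M := by
  obtain ⟨e, t, ht, hnf⟩ :=
    exists_basis_normalForm h2 hU τ ha hb A B hA hB hAB φ hφ hφA hφB hnd
  choose w hw using hd
  refine model_iso_of_normalForm M hM (e := fun i => s (e i))
    (e.linearIndependent.map' s (LinearMap.ker_eq_bot.mpr hs)) (fun i => hds _)
    -- The factor t⁻¹ absorbs the scalar common to the three normal forms.
    (w := fun j => t⁻¹ • w j) fun j => ?_
  rw [map_smul, map_smul, hw, hnf, map_smul, smul_smul, inv_mul_cancel₀ ht, one_smul,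
    map_normalForm]
  simp only [ExteriorAlgebra.map_apply_ι]

end Model

/-! ### The Klein form on the normal forms -/

section Volume

variable {k : Type*} [Field k] {U : Type*} [AddCommGroup U] [Module k U]

/-- Under the quaternion dictionary φ ∧ φ is twice the reduced norm y₀² - a y₁² - b y₂² of y₀ + y₁i
+ y₂j, times the volume; hence the diagonal Gram matrix. -/
theorem normalForm_mul_normalForm (a b : k) (e : Fin 4 → U) (i j : Fin 3) :
    normalForm a b (fun i => ExteriorAlgebra.ι k (e i)) i *
      normalForm a b (fun i => ExteriorAlgebra.ι k (e i)) j =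
    (if i = j then 2 * ![1, -a, -b] i else 0) • (ExteriorAlgebra.ι k (e 0) *
      (ExteriorAlgebra.ι k (e 1) * (ExteriorAlgebra.ι k (e 2) * ExteriorAlgebra.ι k (e 3)))) := by
  have sw := fun i j => ι_mul_ι_swap (k := k) (e i) (e j)
  have sq := fun i => ExteriorAlgebra.ι_sq_zero (R := k) (e i)
  have sw' : ∀ i j z, ExteriorAlgebra.ι k (e i) * (ExteriorAlgebra.ι k (e j) * z) =
      -(ExteriorAlgebra.ι k (e j) * (ExteriorAlgebra.ι k (e i) * z)) := fun i j z => by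
    rw [← mul_assoc, sw, neg_mul, mul_assoc]
  have sq' : ∀ i z, ExteriorAlgebra.ι k (e i) * (ExteriorAlgebra.ι k (e i) * z) = 0 := fun i z => by
    rw [← mul_assoc, sq, zero_mul]
  fin_cases i <;> fin_cases j <;>
    simp only [normalForm, Fin.zero_eta, Fin.mk_one, Fin.reduceFinMk, Fin.isValue, Matrix.cons_val,
      mul_add, add_mul, mul_sub, sub_mul, smul_mul_assoc, mul_smul_comm, mul_assoc, 
      sw 2 1, sw 3 1, sw 3 2, sw' 1 0, sw' 2 0, sw' 3 0, sw' 2 1, sw' 3 1, sw' 3 2,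
      sq, sq', mul_neg, mul_zero, smul_zero, neg_zero] <;>
    simp <;> module

/-- Contracting successively with the dual family leaves a nonzero scalar. -/
theorem volume_ne_zero {e : Fin 4 → U} (he : LinearIndependent k e) :
    ExteriorAlgebra.ι k (e 0) *
      (ExteriorAlgebra.ι k (e 1) * (ExteriorAlgebra.ι k (e 2) * ExteriorAlgebra.ι k (e 3))) ≠ 0 := by
  obtain ⟨α, hα⟩ := exists_dual_family he
  intro h
  have := congrArg (fun x => algebraMapInv (contractLeft (Q := (0 : QuadraticForm k U)) (α 3)
    (contractLeft (Q := (0 : QuadraticForm k U)) (α 2)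
    (contractLeft (Q := (0 : QuadraticForm k U)) (α 1)
    (contractLeft (Q := (0 : QuadraticForm k U)) (α 0) x))))) h
  simp [contractLeft_ι_mul, hα] at this

end Volume

theorem polarBilin_kleinForm {k : Type u} [Field k] {U : Type u} [AddCommGroup U] [Module k U]
    (vol : (⋀[k]^4 U) ≃ₗ[k] k) (D : Submodule k (⋀[k]^2 U)) (x y : D) :
    QuadraticMap.polarBilin (R := k) (M := D) (N := k) ((kleinForm vol).comp D.subtype) x y =
      2 * vol (wedge (k := k) (x : ⋀[k]^2 U) (y : ⋀[k]^2 U)) := by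
  have h : wedge (k := k) (y : ⋀[k]^2 U) (x : ⋀[k]^2 U) = wedge (x : ⋀[k]^2 U) (y : ⋀[k]^2 U) := by
    apply Subtype.ext
    have h := exteriorAlgebra_graded_comm (y : ⋀[k]^2 U).2 (x : ⋀[k]^2 U).2
    rwa [Even.neg_one_pow (by decide), one_mul] at h
  simp [QuadraticMap.polar, kleinForm, h]
  ring

/-! ### Invariants of an algebra whose differential is in normal form -/

section NormalBasis

variable {k : Type u} [Field k]

/-- A basis of the generating space in which the differential is given by `normalForm a b`. -/
structure NormalBasis (M : MinimalAlgebra k) (a b : k) where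
  basis : Module.Basis (Fin 4 ⊕ Fin 3) k M.V
  d_inl : ∀ i, M.d (ExteriorAlgebra.ι k (basis (Sum.inl i))) = 0
  d_inr : ∀ j, M.d (ExteriorAlgebra.ι k (basis (Sum.inr j))) =
    normalForm a b (fun i => ExteriorAlgebra.ι k (basis (Sum.inl i))) j

theorem model_basis_inl (i : Fin 4) :
    ((Pi.basisFun k (Fin 4)).prod (Pi.basisFun k (Fin 3))) (Sum.inl i) = modelGen k i := by
  simp [modelGen]

/-- The defining basis of the model algebra. -/
def modelNormalBasis (a b : k) : NormalBasis (model a b) a b where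
  basis := (Pi.basisFun k (Fin 4)).prod (Pi.basisFun k (Fin 3))
  d_inl i := by
    have h : modelD a b (ExteriorAlgebra.ι k
        (((Pi.basisFun k (Fin 4)).prod (Pi.basisFun k (Fin 3))) (Sum.inl i))) = 0 := by
      rw [model_basis_inl, modelD_modelGen]
    exact h
  d_inr j := by
    have h : modelD a b (ExteriorAlgebra.ι k
        (((Pi.basisFun k (Fin 4)).prod (Pi.basisFun k (Fin 3))) (Sum.inr j))) =
        normalForm a b (fun i => ExteriorAlgebra.ι k
          (((Pi.basisFun k (Fin 4)).prod (Pi.basisFun k (Fin 3))) (Sum.inl i))) j := by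
      simp only [model_basis_inl, modelD_ι]
      simp [Pi.single_apply]
    exact h

namespace NormalBasis

variable {M : MinimalAlgebra k} {a b : k}

/-- The closed generators. -/
def gen (N : NormalBasis M a b) (i : Fin 4) : M.V := N.basis (Sum.inl i)

theorem gen_linearIndependent (N : NormalBasis M a b) : LinearIndependent k N.gen :=
  N.basis.linearIndependent.comp _ Sum.inl_injective

theorem d_ι (N : NormalBasis M a b) (v : M.V) : M.d (ExteriorAlgebra.ι k v) =
    ∑ j, N.basis.repr v (Sum.inr j) •
      normalForm a b (fun i => ExteriorAlgebra.ι k (N.gen i)) j := by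
  conv_lhs => rw [← N.basis.sum_repr v, Fintype.sum_sum_type]
  simp only [map_add, map_sum, map_smul, N.d_inl, N.d_inr, smul_zero, Finset.sum_const_zero,
    zero_add]
  rfl

theorem mem_W_zero (N : NormalBasis M a b) {v : M.V} :
    v ∈ M.W 0 ↔ ∀ j, N.basis.repr v (Sum.inr j) = 0 := by
  change M.d (ExteriorAlgebra.ι k v) = 0 ↔ _
  rw [N.d_ι]
  refine ⟨fun h => Fintype.linearIndependent_iff.mp
    (normalForm_linearIndependent a b N.gen_linearIndependent) _ h, fun h => ?_⟩
  simp [h]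

theorem gen_mem (N : NormalBasis M a b) (i : Fin 4) : N.gen i ∈ M.W 0 := by
  rw [N.mem_W_zero]
  simp [gen]

/-- The closed generators as a basis of `W 0`. -/
def closedBasis (N : NormalBasis M a b) : Module.Basis (Fin 4) k (M.W 0) :=
  Module.Basis.mk (v := fun i => ⟨N.gen i, N.gen_mem i⟩)
    (LinearIndependent.of_comp (M.W 0).subtype N.gen_linearIndependent) (by
      rintro ⟨v, hv⟩ -
      have h : (⟨v, hv⟩ : M.W 0) =
          ∑ i, N.basis.repr v (Sum.inl i) • (⟨N.gen i, N.gen_mem i⟩ : M.W 0) := by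
        apply Subtype.ext
        have hv := N.mem_W_zero.mp hv
        have hs := N.basis.sum_repr v
        rw [Fintype.sum_sum_type] at hs
        simp only [hv, zero_smul, Finset.sum_const_zero, add_zero] at hs
        exact hs.symm.trans (by simp [gen])
      rw [h]
      exact sum_mem fun i _ => Submodule.smul_mem _ _ (Submodule.subset_span ⟨i, rfl⟩))

@[simp] theorem coe_closedBasis (N : NormalBasis M a b) (i : Fin 4) :
    (N.closedBasis i : M.V) = N.gen i := by
  simp [closedBasis]

theorem finrank_V (N : NormalBasis M a b) : Module.finrank k M.V = 7 := by
  rw [Module.finrank_eq_card_basis N.basis]; simp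

theorem finrank_W_zero (N : NormalBasis M a b) : Module.finrank k (M.W 0) = 4 := by
  rw [Module.finrank_eq_card_basis N.closedBasis]; simp

theorem W_one (N : NormalBasis M a b) : M.W 1 = ⊤ := by
  rw [eq_top_iff]
  intro v _
  change M.d (ExteriorAlgebra.ι k v) ∈ ((M.W 0).map (ExteriorAlgebra.ι k)) ^ 2
  rw [N.d_ι]
  have h : ∀ i l, ExteriorAlgebra.ι k (N.gen i) * ExteriorAlgebra.ι k (N.gen l) ∈
      ((M.W 0).map (ExteriorAlgebra.ι k)) ^ 2 := fun i l => by
    rw [pow_two]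
    exact Submodule.mul_mem_mul (Submodule.mem_map_of_mem (N.gen_mem i))
      (Submodule.mem_map_of_mem (N.gen_mem l))
  refine sum_mem fun j _ => Submodule.smul_mem _ _ ?_
  fin_cases j
  · exact add_mem (h 0 3) (h 1 2)
  · exact add_mem (h 0 2) (Submodule.smul_mem _ _ (h 1 3))
  · exact sub_mem (Submodule.smul_mem _ _ (h 2 3)) (h 0 1)

theorem isTypeFourThree (N : NormalBasis M a b) : M.IsTypeFourThree := by
  have : FiniteDimensional k M.V := N.basis.finiteDimensional_of_finite
  refine ⟨N.finrank_V, ⟨⟨one_le_two, N.W_one⟩, ?_⟩, N.finrank_W_zero, ?_⟩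
  · rintro m ⟨h1, hm⟩
    by_contra! h
    obtain rfl : m = 1 := by omega
    have h4 := N.finrank_W_zero
    rw [show M.W 0 = ⊤ from hm, finrank_top, N.finrank_V] at h4
    omega
  · have h := Submodule.finrank_quotient_add_finrank ((M.W 0).submoduleOf (M.W 1))
    have hle : M.W 0 ≤ M.W 1 := by rw [N.W_one]; exact le_top
    rw [(Submodule.submoduleOfEquivOfLe hle).finrank_eq, N.finrank_W_zero] at h
    have h7 : Module.finrank k (M.W 1) = 7 := by rw [N.W_one, finrank_top, N.finrank_V]
    change Module.finrank k (M.W 1 ⧸ (M.W 0).submoduleOf (M.W 1)) = 3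
    omega

/-- The basis of the space of bivectors. -/
def bivector (N : NormalBasis M a b) (j : Fin 3) : ⋀[k]^2 (M.W 0) :=
  ⟨normalForm a b (fun i => ExteriorAlgebra.ι k (N.closedBasis i)) j, normalForm_mem _ j⟩


theorem coe_bivector (N : NormalBasis M a b) (j : Fin 3) :
    (N.bivector j : ExteriorAlgebra k (M.W 0)) =
      normalForm a b (fun i => ExteriorAlgebra.ι k (N.closedBasis i)) j := rfl

theorem bivector_linearIndependent (N : NormalBasis M a b) : LinearIndependent k N.bivector :=
  LinearIndependent.of_comp (⋀[k]^2 (M.W 0)).subtype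
    (normalForm_linearIndependent a b N.closedBasis.linearIndependent)

theorem map_subtype_normalForm (N : NormalBasis M a b) (j : Fin 3) :
    ExteriorAlgebra.map (M.W 0).subtype
      (normalForm a b (fun i => ExteriorAlgebra.ι k (N.closedBasis i)) j) =
      normalForm a b (fun i => ExteriorAlgebra.ι k (N.gen i)) j := by
  rw [map_normalForm]
  simp

theorem bivectors_eq_span (N : NormalBasis M a b) :
    M.bivectors = Submodule.span k (Set.range N.bivector) := by
  apply le_antisymm
  · rintro φ ⟨v, -, hv⟩
    have hv : M.d (ExteriorAlgebra.ι k v) =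
      ExteriorAlgebra.map (M.W 0).subtype (φ : ExteriorAlgebra k (M.W 0)) := hv
    have h : φ = ∑ j, N.basis.repr v (Sum.inr j) • N.bivector j := by
      apply Subtype.ext
      apply ExteriorAlgebra.map_injective_field (Submodule.ker_subtype (M.W 0))
      rw [← hv, N.d_ι]
      simp [coe_bivector, map_subtype_normalForm]
    rw [h]
    exact sum_mem fun j _ => Submodule.smul_mem _ _ (Submodule.subset_span ⟨j, rfl⟩)
  · rw [Submodule.span_le]
    rintro _ ⟨j, rfl⟩
    refine ⟨N.basis (Sum.inr j), ?_, ?_⟩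
    · rw [N.W_one]; trivial
    · exact (N.d_inr j).trans (N.map_subtype_normalForm j).symm

theorem cutsSmoothConic (N : NormalBasis M a b) (h2 : (2 : k) ≠ 0) (ha : a ≠ 0) (hb : b ≠ 0) :
    CutsSmoothConic M.bivectors := by
  have : FiniteDimensional k M.V := N.basis.finiteDimensional_of_finite
  have hvol : Module.finrank k (⋀[k]^4 (M.W 0)) = 1 := by
    rw [exteriorPower.finrank_eq, N.finrank_W_zero]; rfl
  set vol : (⋀[k]^4 (M.W 0)) ≃ₗ[k] k := LinearEquiv.ofFinrankEq _ _ (by simp [hvol]) with hvoldef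
  refine ⟨?_, vol, ?_⟩
  · rw [N.bivectors_eq_span, finrank_span_eq_card N.bivector_linearIndependent]; simp
  have hmem : ExteriorAlgebra.ι k (N.closedBasis 0) * (ExteriorAlgebra.ι k (N.closedBasis 1) *
      (ExteriorAlgebra.ι k (N.closedBasis 2) * ExteriorAlgebra.ι k (N.closedBasis 3))) ∈
      ⋀[k]^4 (M.W 0) :=
    ι_mul_mem_exteriorPower _ (ι_mul_mem_exteriorPower _ (ι_mul_ι_mem_exteriorPower_two _ _))
  have hw : ∀ i j, wedge (k := k) (N.bivector i) (N.bivector j) =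
      (if i = j then 2 * ![1, -a, -b] i else 0) • (⟨_, hmem⟩ : ⋀[k]^4 (M.W 0)) := fun i j =>
    Subtype.ext (normalForm_mul_normalForm a b (fun i => N.closedBasis i) i j)
  have hne := volume_ne_zero N.closedBasis.linearIndependent
  have hc : ∀ j, ![1, -a, -b] j ≠ 0 := by
    intro j; fin_cases j <;> simp [ha, hb]
  set P := QuadraticMap.polarBilin (R := k) (M := M.bivectors) (N := k)
    ((kleinForm vol).comp M.bivectors.subtype) with hP
  have left : P.SeparatingLeft := by
    rintro ⟨x, hx⟩ h
    have hx' := hx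
    rw [N.bivectors_eq_span, Submodule.mem_span_range_iff_exists_fun] at hx'
    obtain ⟨c, rfl⟩ := hx'
    have hc0 : ∀ j, c j = 0 := by
      intro j
      have hj : N.bivector j ∈ M.bivectors := by
        rw [N.bivectors_eq_span]; exact Submodule.subset_span ⟨j, rfl⟩
      have := h ⟨_, hj⟩
      rw [hP, polarBilin_kleinForm] at this
      simpa [hw, h2, hne, hc] using this
    simp [hc0]
  -- The polar form is symmetric, so separation on one side gives the other.
  refine ⟨left, fun y h => left y fun x => ?_⟩
  rw [← h x]
  exact QuadraticMap.polar_comm _ _ _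

end NormalBasis
end NormalBasis

/-! ### From an orthogonal basis of bivectors to anticommuting operators -/

section Operators

variable {k : Type*} [Field k] {U : Type*} [AddCommGroup U] [Module k U]

/-- Contracting u ∧ V₀ ∈ ⋀⁵U = 0 with α gives α(u)V₀ = u ∧ (α ⌟ V₀). -/
theorem contractLeft_volume_injective (hU : Module.finrank k U = 4) {V₀ : ExteriorAlgebra k U}
    (hV : V₀ ∈ ⋀[k]^4 U) (hV0 : V₀ ≠ 0) {α : Module.Dual k U}
    (h : contractLeft (Q := (0 : QuadraticForm k U)) α V₀ = 0) : α = 0 := by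
  have : FiniteDimensional k U := Module.finite_of_finrank_pos (by omega)
  have h5 : Module.finrank k (⋀[k]^5 U) = 0 := by
    rw [exteriorPower.finrank_eq, hU]; rfl
  have h5' : ⋀[k]^5 U = ⊥ := Submodule.finrank_eq_zero.mp h5
  ext u
  have hu : ExteriorAlgebra.ι k u * V₀ = 0 := by
    rw [← Submodule.mem_bot k, ← h5']
    exact ι_mul_mem_exteriorPower u hV
  have := contractLeft_ι_mul (Q := (0 : QuadraticForm k U)) α u V₀
  rw [h, mul_zero, sub_zero] at this
  have e : ExteriorAlgebra.ι k u * V₀ = CliffordAlgebra.ι 0 u * V₀ := rfl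
  rw [← e, hu, map_zero] at this
  simpa using (smul_eq_zero.mp this.symm).resolve_right hV0

/-- Three mutually orthogonal bivectors with nonzero squares in dimension four are related by
anticommuting operators on the dual space with scalar squares. -/
theorem exists_operators (hU : Module.finrank k U = 4)
    {V₀ : ExteriorAlgebra k U} (hV : V₀ ∈ ⋀[k]^4 U) (hV0 : V₀ ≠ 0)
    (φ : Fin 3 → ExteriorAlgebra k U) (hφ : ∀ j, φ j ∈ ⋀[k]^2 U) (c : Fin 3 → k)
    (hc : ∀ j, c j ≠ 0) (hmul : ∀ i j, φ i * φ j = (if i = j then c i else 0) • V₀) :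
    ∃ A B : Module.Dual k U →ₗ[k] Module.Dual k U,
      (∀ α, A (A α) = (-c 1 / c 0) • α) ∧ (∀ α, B (B α) = (-c 2 / c 0) • α) ∧
      (∀ α, A (B α) = -B (A α)) ∧
      (∀ α β, bform (φ 1) α β = bform (φ 0) (A α) β) ∧
      (∀ α β, bform (φ 2) α β = bform (φ 0) (B α) β) ∧
      ∀ α, (∀ β, bform (φ 0) α β = 0) → α = 0 := by
  have : FiniteDimensional k U := Module.finite_of_finrank_pos (by omega)
  set C : Fin 3 → Module.Dual k U →ₗ[k] U := fun j =>
    ιInv ∘ₗ (contractLeft (Q := (0 : QuadraticForm k U))).flip (φ j) with hC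
  have hιC : ∀ j α, ExteriorAlgebra.ι k (C j α) =
      contractLeft (Q := (0 : QuadraticForm k U)) α (φ j) :=
    fun j α => ι_ιInv_contractLeft α (hφ j)
  have hbf : ∀ j α β, bform (φ j) α β = β (C j α) := by
    intro j α β
    rw [bform_apply, ← hιC, contractLeft_ι]
    exact algebraMap_leftInverse _ _
  set T : Module.Dual k U →ₗ[k] ExteriorAlgebra k U :=
    (contractLeft (Q := (0 : QuadraticForm k U))).flip V₀ with hT
  have hTinj : ∀ α β, T α = T β → α = β := fun α β h => by
    rw [← sub_eq_zero]
    refine contractLeft_volume_injective hU hV hV0 ?_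
    change T (α - β) = 0
    rw [map_sub, h, sub_self]
  -- Contract φᵢ ∧ φⱼ with α; a bivector commutes with vectors, so the two terms take a symmetric
  -- form.
  have key : ∀ i j α, ExteriorAlgebra.ι k (C i α) * φ j + ExteriorAlgebra.ι k (C j α) * φ i =
      (if i = j then c i else 0) • T α := by
    intro i j α
    have h := contractLeft_bivector_mul α (hφ i) (φ j)
    rw [hmul, map_smul, ← hιC, ← hιC, ← bivector_comm (hφ i)] at h
    exact h.symm
  have k00 : ∀ α, (2 : k) • (ExteriorAlgebra.ι k (C 0 α) * φ 0) = c 0 • T α := fun α => by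
    rw [two_smul, key]; simp
  have k11 : ∀ α, (2 : k) • (ExteriorAlgebra.ι k (C 1 α) * φ 1) = c 1 • T α := fun α => by
    rw [two_smul, key]; simp
  have k22 : ∀ α, (2 : k) • (ExteriorAlgebra.ι k (C 2 α) * φ 2) = c 2 • T α := fun α => by
    rw [two_smul, key]; simp
  have koff : ∀ i j α, i ≠ j → ExteriorAlgebra.ι k (C i α) * φ j =
      -(ExteriorAlgebra.ι k (C j α) * φ i) := fun i j α hij => by
    rw [eq_neg_iff_add_eq_zero, key, if_neg hij, zero_smul]
  have hC0 : Function.Injective (C 0) := by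
    rw [← LinearMap.ker_eq_bot, LinearMap.ker_eq_bot']
    intro α h
    have h0 := k00 α
    rw [h, map_zero, zero_mul, smul_zero] at h0
    apply hTinj
    rw [map_zero]
    exact (smul_eq_zero.mp h0.symm).resolve_left (hc 0)
  set E := (C 0).linearEquivOfInjective hC0 Subspace.dual_finrank_eq with hE
  have hE' : ∀ u, C 0 (E.symm u) = u := fun u => E.apply_symm_apply u
  -- The operators are C₀⁻¹Cⱼ, characterised by this equation.
  have hA : ∀ j α, C 0 ((E.symm.toLinearMap ∘ₗ C j) α) = C j α := fun j α => hE' _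
  have hcancel : ∀ α β, (c 0) • T α = (c 0) • T β → α = β := fun α β h =>
    hTinj _ _ (smul_right_injective _ (hc 0) h)
  have sq : ∀ j, j ≠ 0 → (∀ α, (2 : k) • (ExteriorAlgebra.ι k (C j α) * φ j) = c j • T α) → ∀ α,
      (E.symm.toLinearMap ∘ₗ C j) ((E.symm.toLinearMap ∘ₗ C j) α) = (-c j / c 0) • α := by
    intro j hj kjj α
    apply hcancel
    rw [← k00, hA, koff j 0 _ hj, hA, smul_neg, kjj, map_smul, smul_smul, mul_div_cancel₀ _ (hc 0),
      neg_smul]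
  refine ⟨E.symm.toLinearMap ∘ₗ C 1, E.symm.toLinearMap ∘ₗ C 2, sq 1 (by decide) k11,
    sq 2 (by decide) k22, fun α => ?_, fun α β => ?_, fun α β => ?_, fun α h => ?_⟩
  -- Moving indices with `koff` turns C₀(ABα) ∧ φ₀ into -C₂α ∧ φ₁ and C₀(BAα) ∧ φ₀ into -C₁α ∧ φ₂ =
  -- C₂α ∧ φ₁.
  · apply hcancel
    rw [map_neg, smul_neg, ← k00, ← k00, hA, hA, koff 1 0 _ (by decide), koff 2 0 _ (by decide),
      hA, hA, koff 1 2 _ (by decide)]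
    simp
  · rw [hbf, hbf, hA]
  · rw [hbf, hbf, hA]
  · apply hC0
    rw [map_zero, ← Module.forall_dual_apply_eq_zero_iff k]
    intro β
    rw [← hbf, h]

end Operators

theorem exists_orthogonal_basis_of_finrank {k D : Type*} [Field k] (h2 : (2 : k) ≠ 0)
    [AddCommGroup D] [Module k D] {P : D →ₗ[k] D →ₗ[k] k} (hP : LinearMap.IsSymm P) {n : ℕ}
    (hn : 0 < n) (hD : Module.finrank k D = n) :
    ∃ v : Module.Basis (Fin n) k D, P.IsOrthoᵢ v := by
  have : FiniteDimensional k D := Module.finite_of_finrank_pos (by omega)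
  have : Invertible (2 : k) := invertibleOfNonzero h2
  have := LinearMap.BilinForm.exists_orthogonal_basis hP
  rwa [hD] at this

/-- Since 2 ≠ 0, the conic has an orthogonal basis, and regularity makes its diagonal entries
nonzero; a and b are the negatives of their ratios. No rational point is needed. -/
theorem exists_iso_model {k : Type u} [Field k] (h2 : (2 : k) ≠ 0) (M : MinimalAlgebra k)
    (hM : M.IsTypeFourThree) (hQ : CutsSmoothConic M.bivectors) :
    ∃ a b : kˣ, (model (a : k) (b : k)).Iso M := by
  obtain ⟨h7, -, hf0, -⟩ := hM
  have hU : Module.finrank k (M.W 0) = 4 := hf0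
  obtain ⟨h3, vol, hnd⟩ := hQ
  set P := QuadraticMap.polarBilin (R := k) (M := M.bivectors) (N := k)
    ((kleinForm vol).comp M.bivectors.subtype) with hP
  have hsymm : LinearMap.IsSymm P := ⟨fun x y => QuadraticMap.polar_comm _ _ _⟩
  obtain ⟨v, hv⟩ : ∃ v : Module.Basis (Fin 3) k M.bivectors, P.IsOrthoᵢ v := by
    exact exists_orthogonal_basis_of_finrank (D := M.bivectors) (P := P) h2 hsymm (by norm_num) h3
  set c : Fin 3 → k := fun j => vol (wedge (k := k) (v j : ⋀[k]^2 (M.W 0)) (v j)) with hcdef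
  have hc : ∀ j, c j ≠ 0 := fun j h => by
    refine hv.not_isOrtho_basis_self_of_separatingLeft hnd.1 j ?_
    rw [hP, polarBilin_kleinForm]
    change 2 * c j = 0
    rw [h, mul_zero]
  have hoff : ∀ i j, i ≠ j → vol (wedge (k := k) (v i : ⋀[k]^2 (M.W 0)) (v j)) = 0 := by
    intro i j hij
    have h : P (v i) (v j) = 0 := hv hij
    rw [hP, polarBilin_kleinForm] at h
    exact (mul_eq_zero.mp h).resolve_left h2
  have hmul : ∀ i j, ((v i : ⋀[k]^2 (M.W 0)) : ExteriorAlgebra k (M.W 0)) *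
      ((v j : ⋀[k]^2 (M.W 0)) : ExteriorAlgebra k (M.W 0)) = (if i = j then c i else 0) •
        ((vol.symm 1 : ⋀[k]^4 (M.W 0)) : ExteriorAlgebra k (M.W 0)) := by
    intro i j
    have h : wedge (k := k) (v i : ⋀[k]^2 (M.W 0)) (v j) =
        (if i = j then c i else 0) • vol.symm 1 := by
      apply vol.injective
      rw [map_smul, LinearEquiv.apply_symm_apply, smul_eq_mul, mul_one]
      split_ifs with hij
      · rw [hij]
      · exact hoff i j hij
    exact congrArg Subtype.val h
  obtain ⟨A, B, hA, hB, hAB, hφA, hφB, hnd⟩ := exists_operators hU (vol.symm 1).2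
    (fun h => one_ne_zero ((LinearEquiv.map_eq_zero_iff vol.symm).mp (Subtype.ext h)))
    (fun j => ((v j : ⋀[k]^2 (M.W 0)) : ExteriorAlgebra k (M.W 0))) (fun j => (v j).1.2) c hc hmul
  have ha : -c 1 / c 0 ≠ 0 := div_ne_zero (neg_ne_zero.mpr (hc 1)) (hc 0)
  have hb : -c 2 / c 0 ≠ 0 := div_ne_zero (neg_ne_zero.mpr (hc 2)) (hc 0)
  refine ⟨Units.mk0 _ ha, Units.mk0 _ hb, model_iso_of_operators h2 ha hb M h7 hU (M.W 0).subtype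
    Subtype.val_injective (fun u => u.2) (LinearEquiv.refl k _) A B hA hB hAB _
    (fun j => (v j).1.2) hφA hφB hnd fun j => ?_⟩
  obtain ⟨w, -, hw⟩ := (v j).2
  exact ⟨w, hw⟩

/-! ### Recovering the quaternion algebra from its alternating forms -/

section Quaternion

variable {k : Type*} [Field k] {a b a' b' : k}

theorem quatForm_nondegenerate {x : ℍ[k, a, b]} (h : ∀ y, quatForm x y = 0) : x = 0 := by
  have h0 := h ⟨1, 0, 0, 0⟩
  have h1 := h ⟨0, 1, 0, 0⟩
  have h2 := h ⟨0, 0, 1, 0⟩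
  have h3 := h ⟨0, 0, 0, 1⟩
  simp [quatForm] at h0 h1 h2 h3
  ext <;> simpa

theorem quatForm_sub_left (x y z : ℍ[k, a, b]) :
    quatForm (x - y) z = quatForm x z - quatForm y z := by
  simp [quatForm]; ring

/-- The element of the second algebra matching y = 1 is some u, not necessarily 1. Dividing by u,
left multiplication by i and j is transported through g to left multiplication by elements p and q,
which therefore satisfy the relations of (a, b). -/
theorem algEquiv_of_quatForm (g : ℍ[k, a', b'] →ₗ[k] ℍ[k, a, b]) (hg : Function.Injective g)
    (h : ∀ y : Fin 3 → k, ∃ y' : Fin 3 → k, ∀ x x',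
      quatForm ((⟨y 0, y 1, y 2, 0⟩ : ℍ[k, a, b]) * g x) (g x') =
        quatForm ((⟨y' 0, y' 1, y' 2, 0⟩ : ℍ[k, a', b']) * x) x') :
    Nonempty (ℍ[k, a, b] ≃ₐ[k] ℍ[k, a', b']) := by
  have hdim : Module.finrank k ℍ[k, a', b'] = Module.finrank k ℍ[k, a, b] := by
    rw [QuaternionAlgebra.finrank_eq_four, QuaternionAlgebra.finrank_eq_four]
  have hsurj : Function.Surjective g :=
    (LinearMap.injective_iff_surjective_of_finrank_eq_finrank hdim).mp hg
  have hsep : ∀ x y, (∀ x', quatForm x (g x') = quatForm y (g x')) → x = y := fun x y hxy => by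
    rw [← sub_eq_zero]
    refine quatForm_nondegenerate fun z => ?_
    obtain ⟨x', rfl⟩ := hsurj z
    rw [quatForm_sub_left, hxy, sub_self]
  obtain ⟨y₀, hy₀⟩ := h ![1, 0, 0]
  set u : ℍ[k, a', b'] := ⟨y₀ 0, y₀ 1, y₀ 2, 0⟩ with hu
  have hone : (⟨![(1 : k), 0, 0] 0, ![(1 : k), 0, 0] 1, ![(1 : k), 0, 0] 2, 0⟩ : ℍ[k, a, b]) = 1 := by
    ext <;> simp
  simp only [hone, one_mul] at hy₀
  -- Nondegeneracy of the form, together with injectivity of g, makes u invertible.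
  have hui : Function.Injective (LinearMap.mulLeft k u) := by
    rw [← LinearMap.ker_eq_bot, LinearMap.ker_eq_bot']
    intro x hx
    apply hg
    apply hsep
    intro x'
    have hx : u * x = 0 := hx
    rw [hy₀, hx, map_zero]
    simp [quatForm]
  have hus := LinearMap.surjective_of_injective hui
  have hmul : ∀ y : Fin 3 → k, ∃ p, ∀ x, (⟨y 0, y 1, y 2, 0⟩ : ℍ[k, a, b]) * g x = g (p * x) := by
    intro y
    obtain ⟨y', hy'⟩ := h y
    obtain ⟨p, hp⟩ := hus ⟨y' 0, y' 1, y' 2, 0⟩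
    have hp : u * p = ⟨y' 0, y' 1, y' 2, 0⟩ := hp
    refine ⟨p, fun x => hsep _ _ fun x' => ?_⟩
    rw [hy', hy₀, ← hp, mul_assoc]
  obtain ⟨p, hp⟩ := hmul ![0, 1, 0]
  obtain ⟨q, hq⟩ := hmul ![0, 0, 1]
  simp only [Matrix.cons_val] at hp hq
  have hi : (⟨0, 1, 0, 0⟩ : ℍ[k, a, b]) * ⟨0, 1, 0, 0⟩ = a • 1 := by ext <;> simp
  have hj : (⟨0, 0, 1, 0⟩ : ℍ[k, a, b]) * ⟨0, 0, 1, 0⟩ = b • 1 := by ext <;> simp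
  have hij : (⟨0, 1, 0, 0⟩ : ℍ[k, a, b]) * ⟨0, 0, 1, 0⟩ = ⟨0, 0, 0, 1⟩ := by ext <;> simp
  have hji : (⟨0, 0, 1, 0⟩ : ℍ[k, a, b]) * ⟨0, 1, 0, 0⟩ = -⟨0, 0, 0, 1⟩ := by ext <;> simp
  have hk : ∀ x, (⟨0, 0, 0, 1⟩ : ℍ[k, a, b]) * g x = g (p * q * x) := fun x => by
    rw [← hij, mul_assoc, hq, hp, mul_assoc]
  have hpp : p * p = a • 1 := hg <| calc
    g (p * p) = ⟨0, 1, 0, 0⟩ * (⟨0, 1, 0, 0⟩ * g 1) := by rw [hp, hp, mul_one]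
    _ = g (a • 1) := by rw [← mul_assoc, hi, map_smul, smul_mul_assoc, one_mul]
  have hqq : q * q = b • 1 := hg <| calc
    g (q * q) = ⟨0, 0, 1, 0⟩ * (⟨0, 0, 1, 0⟩ * g 1) := by rw [hq, hq, mul_one]
    _ = g (b • 1) := by rw [← mul_assoc, hj, map_smul, smul_mul_assoc, one_mul]
  have hqp : q * p = -(p * q) := hg <| calc
    g (q * p) = ⟨0, 0, 1, 0⟩ * (⟨0, 1, 0, 0⟩ * g 1) := by rw [hp, hq, mul_one]
    _ = g (-(p * q)) := by rw [← mul_assoc, hji, neg_mul, hk, mul_one, map_neg]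
  set Q : QuaternionAlgebra.Basis ℍ[k, a', b'] a 0 b :=
    { i := p, j := q, k := p * q
      i_mul_i := by rw [hpp, zero_smul, add_zero]
      j_mul_j := hqq
      i_mul_j := rfl
      j_mul_i := by rw [hqp, zero_smul, zero_sub] } with hQ
  have hΦ : ∀ z x, g (Q.liftHom z * x) = z * g x := by
    intro z x
    have hz : z = z.re • 1 + z.imI • ⟨0, 1, 0, 0⟩ + z.imJ • ⟨0, 0, 1, 0⟩ + z.imK • ⟨0, 0, 0, 1⟩ := by
      ext <;> simp
    conv_rhs => rw [hz]
    simp only [add_mul, smul_mul_assoc, one_mul, hp, hq, hk]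
    simp [QuaternionAlgebra.Basis.lift, add_mul, hQ, Algebra.algebraMap_eq_smul_one]
  have hinj : Function.Injective Q.liftHom.toLinearMap := by
    rw [← LinearMap.ker_eq_bot, LinearMap.ker_eq_bot']
    intro z hz
    have hz : Q.liftHom z = 0 := hz
    obtain ⟨x, hx⟩ := hsurj 1
    have := hΦ z x
    rwa [hz, zero_mul, map_zero, hx, mul_one, eq_comm] at this
  exact ⟨AlgEquiv.ofBijective Q.liftHom
    ⟨hinj, (LinearMap.injective_iff_surjective_of_finrank_eq_finrank hdim.symm).mp hinj⟩⟩

/-- If the real part were nonzero, p² being scalar would force p to be scalar; then p commutes and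
anticommutes with q, so q = 0, against q² = d ≠ 0. -/
theorem re_eq_zero_of_anticomm (h2 : (2 : k) ≠ 0) {p q : ℍ[k, a, b]} {c d : k} (hd : d ≠ 0)
    (hp : p * p = c • 1) (hq : q * q = d • 1) (hpq : p * q = -(q * p)) : p.re = 0 := by
  by_contra h
  have h1 := congrArg QuaternionAlgebra.imI hp
  have h2' := congrArg QuaternionAlgebra.imJ hp
  have h3 := congrArg QuaternionAlgebra.imK hp
  simp at h1 h2' h3
  have hp' : p = p.re • 1 := by
    have e1 : p.imI = 0 := by
      have : 2 * p.re * p.imI = 0 := by linear_combination h1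
      simpa [h2, h] using this
    have e2 : p.imJ = 0 := by
      have : 2 * p.re * p.imJ = 0 := by linear_combination h2'
      simpa [h2, h] using this
    have e3 : p.imK = 0 := by
      have : 2 * p.re * p.imK = 0 := by linear_combination h3
      simpa [h2, h] using this
    ext <;> simp [e1, e2, e3]
  rw [hp', smul_mul_assoc, mul_smul_comm, one_mul, mul_one, eq_neg_iff_add_eq_zero, ← two_smul k,
    smul_smul, smul_eq_zero] at hpq
  have hq0 := hpq.resolve_left (mul_ne_zero h2 h)
  rw [hq0, mul_zero] at hq
  have := congrArg QuaternionAlgebra.re hq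
  simp at this
  exact hd this.symm

end Quaternion

/-! ### Isomorphisms of algebras versus isomorphisms of quaternion algebras -/

section Comparison

variable {k : Type u} [Field k] {M M' : MinimalAlgebra k} {a b a' b' : k}

theorem MinimalAlgebra.d_ι_mem (M : MinimalAlgebra k) (v : M.V) :
    M.d (ExteriorAlgebra.ι k v) ∈ ⋀[k]^2 M.V :=
  M.isCDGA.degree 1 _ (ι_mem_exteriorPower_one v)

namespace NormalBasis

/-- The values of a linear form on the closed generators, as a quaternion. -/
def restrict (N : NormalBasis M a b) : Module.Dual k M.V →ₗ[k] ℍ[k, a, b] where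
  toFun α := ⟨α (N.gen 0), α (N.gen 1), α (N.gen 2), α (N.gen 3)⟩
  map_add' α β := by ext <;> simp
  map_smul' c α := by ext <;> simp

/-- The linear form with given values on the closed generators. -/
def extend (N : NormalBasis M a b) : ℍ[k, a, b] →ₗ[k] Module.Dual k M.V where
  toFun x := x.re • N.basis.coord (Sum.inl 0) + x.imI • N.basis.coord (Sum.inl 1) +
    x.imJ • N.basis.coord (Sum.inl 2) + x.imK • N.basis.coord (Sum.inl 3)
  map_add' x y := by simp; module
  map_smul' c x := by simp; module

@[simp] theorem restrict_extend (N : NormalBasis M a b) (x : ℍ[k, a, b]) :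
    N.restrict (N.extend x) = x := by
  ext <;> simp [restrict, extend, gen]

theorem bform_d (N : NormalBasis M a b) (v : M.V) (α β : Module.Dual k M.V) :
    bform (M.d (ExteriorAlgebra.ι k v)) α β = quatForm
      ((⟨N.basis.repr v (Sum.inr 0), N.basis.repr v (Sum.inr 1), N.basis.repr v (Sum.inr 2), 0⟩ :
        ℍ[k, a, b]) * N.restrict α) (N.restrict β) := by
  rw [N.d_ι, bform_normalForm a b N.gen (fun j => N.basis.repr v (Sum.inr j))]
  rfl

theorem algEquiv_of_iso (N : NormalBasis M a b) (N' : NormalBasis M' a' b') (h : M.Iso M') :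
    Nonempty (ℍ[k, a, b] ≃ₐ[k] ℍ[k, a', b']) := by
  obtain ⟨f, hdeg, hd⟩ := h
  set F : M.V →ₗ[k] M'.V := ιInv ∘ₗ f.toLinearMap ∘ₗ ExteriorAlgebra.ι k with hF
  have hFι : ∀ v, f (ExteriorAlgebra.ι k v) = ExteriorAlgebra.ι k (F v) := by
    intro v
    have h1 := (hdeg 1 _).mpr (ι_mem_exteriorPower_one v)
    rw [exteriorPower, pow_one] at h1
    obtain ⟨w, hw⟩ := h1
    have : F v = w := by
      change ιInv (f (ExteriorAlgebra.ι k v)) = w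
      rw [← hw, ι_leftInverse]
    rw [this, hw]
  have hfF : ∀ x, f x = ExteriorAlgebra.map F x := by
    have : (f : _ →ₐ[k] _) = ExteriorAlgebra.map F := by
      apply ExteriorAlgebra.hom_ext
      ext v
      simpa using hFι v
    exact fun x => AlgHom.congr_fun this x
  have hform : ∀ v α β, bform (M.d (ExteriorAlgebra.ι k v)) (α ∘ₗ F) (β ∘ₗ F) =
      bform (M'.d (ExteriorAlgebra.ι k (F v))) α β := by
    intro v α β
    rw [← bform_map F (M.d_ι_mem v), ← hfF, hd, hFι]
  -- The transpose of F on linear forms, restricted to closed generators. It reverses direction, and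
  -- `N'.extend` is an arbitrary choice of extension.
  set g : ℍ[k, a', b'] →ₗ[k] ℍ[k, a, b] := N.restrict ∘ₗ F.dualMap ∘ₗ N'.extend with hg
  have hgx : ∀ x, g x = N.restrict (N'.extend x ∘ₗ F) := fun x => rfl
  have hinj : Function.Injective g := by
    rw [← LinearMap.ker_eq_bot, LinearMap.ker_eq_bot']
    intro x hx
    have hx0 : ∀ i, N'.extend x (F (N.gen i)) = 0 := by
      rw [hgx] at hx
      have h0 := congrArg QuaternionAlgebra.re hx
      have h1 := congrArg QuaternionAlgebra.imI hx
      have h2 := congrArg QuaternionAlgebra.imJ hx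
      have h3 := congrArg QuaternionAlgebra.imK hx
      intro i
      fin_cases i <;> assumption
    -- Every closed generator of M' is the image of a closed element of M, hence of a combination of
    -- the `N.gen i`, where the pulled-back form vanishes.
    have hgen : ∀ i, N'.extend x (N'.gen i) = 0 := by
      intro i
      have h1 : f.symm (ExteriorAlgebra.ι k (N'.gen i)) ∈ ⋀[k]^1 M.V := by
        rw [← hdeg, AlgEquiv.apply_symm_apply]
        exact ι_mem_exteriorPower_one _
      rw [exteriorPower, pow_one] at h1
      obtain ⟨w, hw⟩ := h1
      have hfw : f (ExteriorAlgebra.ι k w) = ExteriorAlgebra.ι k (N'.gen i) := by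
        rw [hw, AlgEquiv.apply_symm_apply]
      have hFw : F w = N'.gen i := by
        rw [← ExteriorAlgebra.ι_inj k, ← hFι, hfw]
      have hdw : M.d (ExteriorAlgebra.ι k w) = 0 := by
        apply f.injective
        rw [hd, hfw, map_zero]
        exact N'.d_inl i
      have hw0 := N.mem_W_zero.mp (show w ∈ M.W 0 from hdw)
      have hs := N.basis.sum_repr w
      rw [Fintype.sum_sum_type] at hs
      simp only [hw0, zero_smul, Finset.sum_const_zero, add_zero] at hs
      rw [← hFw, ← hs, map_sum, map_sum]
      refine Finset.sum_eq_zero fun l _ => ?_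
      rw [map_smul, map_smul]
      exact (congrArg _ (hx0 l)).trans (smul_zero _)
    rw [← N'.restrict_extend x]
    ext <;> simp only [restrict, LinearMap.coe_mk, AddHom.coe_mk, hgen] <;> simp
  refine algEquiv_of_quatForm g hinj fun y => ?_
  set v : M.V := ∑ j, y j • N.basis (Sum.inr j) with hv
  have hrepr : ∀ j, N.basis.repr v (Sum.inr j) = y j := by
    intro j
    simp [hv, Finsupp.single_apply]
  refine ⟨fun j => N'.basis.repr (F v) (Sum.inr j), fun x x' => ?_⟩
  have := hform v (N'.extend x) (N'.extend x')
  rw [N.bform_d, N'.bform_d, restrict_extend, restrict_extend] at this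
  simp only [hrepr] at this
  exact this

theorem model_iso_of_algEquiv (N' : NormalBasis M' a' b') (h2 : (2 : k) ≠ 0) (ha : a ≠ 0)
    (hb : b ≠ 0) (ha' : a' ≠ 0) (hb' : b' ≠ 0) (Φ : ℍ[k, a, b] ≃ₐ[k] ℍ[k, a', b']) :
    (model a b).Iso M' := by
  set p := Φ ⟨0, 1, 0, 0⟩ with hp
  set q := Φ ⟨0, 0, 1, 0⟩ with hq
  have hpp : p * p = a • 1 := by
    rw [hp, ← map_mul, ← map_one Φ, ← map_smul]; congr 1; ext <;> simp
  have hqq : q * q = b • 1 := by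
    rw [hq, ← map_mul, ← map_one Φ, ← map_smul]; congr 1; ext <;> simp
  have hpq : p * q = -(q * p) := by
    rw [hp, hq, ← map_mul, ← map_mul, ← map_neg]; congr 1; ext <;> simp
  have hqp : q * p = -(p * q) := by rw [hpq, neg_neg]
  have hpqp : p * q * p = -(a • q) := by
    rw [mul_assoc, hqp, mul_neg, ← mul_assoc, hpp, smul_mul_assoc, one_mul]
  have hpqq : p * q * q = b • p := by rw [mul_assoc, hqq, mul_smul_comm, mul_one]
  have rep : p.re = 0 := re_eq_zero_of_anticomm h2 hb hpp hqq hpq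
  have req : q.re = 0 := re_eq_zero_of_anticomm h2 ha hqq hpp hqp
  have repq : (p * q).re = 0 := by
    refine re_eq_zero_of_anticomm h2 ha (c := -(a * b)) ?_ hpp ?_
    · rw [← mul_assoc, hpqp, neg_mul, smul_mul_assoc, hqq, smul_smul, neg_smul]
    · rw [hpqp, ← mul_assoc, hpp, smul_mul_assoc, one_mul]
  -- With κ = ij in (a', b'), left multiplication by κ sends pure quaternions into the span of 1, i,
  -- j.
  have hκ : ∀ r : ℍ[k, a', b'], r.re = 0 → ((⟨0, 0, 0, 1⟩ : ℍ[k, a', b']) * r).imK = 0 := by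
    intro r hr
    simp [hr]
  -- The span of 1, p, q need not be that of 1, i, j. Since pq, p and q are pure, the factor κ(pq)
  -- corrects this: u, up and uq are κ times scalar multiples of pq, q and p.
  set u : ℍ[k, a', b'] := ⟨0, 0, 0, 1⟩ * (p * q) with hu
  set r : Fin 3 → ℍ[k, a', b'] := ![u, u * p, u * q] with hr
  have hrK : ∀ j, (r j).imK = 0 := by
    intro j
    fin_cases j
    · exact hκ _ repq
    · change (u * p).imK = 0
      rw [hu, mul_assoc, hpqp]
      exact hκ _ (by simp [req])
    · change (u * q).imK = 0
      rw [hu, mul_assoc, hpqq]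
      exact hκ _ (by simp [rep])
  -- u is the product of κ, p and q, each with nonzero scalar square.
  have hcancel : ∀ x, u * x = 0 → x = 0 := by
    intro x hx
    have hκκ : (⟨0, 0, 0, 1⟩ : ℍ[k, a', b']) * ⟨0, 0, 0, 1⟩ = (-(a' * b')) • 1 := by
      ext <;> simp
    have e1 : (⟨0, 0, 0, 1⟩ : ℍ[k, a', b']) * (u * x) = (-(a' * b')) • (p * q * x) := by
      rw [hu, mul_assoc, ← mul_assoc (⟨0, 0, 0, 1⟩ : ℍ[k, a', b']) ⟨0, 0, 0, 1⟩, hκκ,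
        smul_mul_assoc, one_mul]
    have e2 : p * (p * q * x) = a • (q * x) := by
      rw [mul_assoc, ← mul_assoc p p, hpp, smul_mul_assoc, one_mul]
    have e3 : q * (q * x) = b • x := by rw [← mul_assoc, hqq, smul_mul_assoc, one_mul]
    rw [hx, mul_zero] at e1
    rw [(smul_eq_zero.mp e1.symm).resolve_left (neg_ne_zero.mpr (mul_ne_zero ha' hb')),
      mul_zero] at e2
    rw [(smul_eq_zero.mp e2.symm).resolve_left ha, mul_zero] at e3
    exact (smul_eq_zero.mp e3.symm).resolve_left hb
  set y : Fin 3 → Fin 3 → k := fun j => ![(r j).re, (r j).imI, (r j).imJ] with hy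
  have hyr : ∀ j, (⟨y j 0, y j 1, y j 2, 0⟩ : ℍ[k, a', b']) = r j := by
    intro j
    ext <;> simp [hy, hrK]
  set τ : ℍ[k, a', b'] ≃ₗ[k] Module.Dual k (M'.W 0) :=
    (QuaternionAlgebra.linearEquivTuple a' 0 b').trans (N'.closedBasis.constr k) with hτ
  have hτe : ∀ x : ℍ[k, a', b'], (⟨τ x (N'.closedBasis 0), τ x (N'.closedBasis 1),
      τ x (N'.closedBasis 2), τ x (N'.closedBasis 3)⟩ : ℍ[k, a', b']) = x := by
    intro x
    ext <;> simp [hτ]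
  set φ : Fin 3 → ExteriorAlgebra k (M'.W 0) := fun j => ∑ l, y j l •
    normalForm a' b' (fun i => ExteriorAlgebra.ι k (N'.closedBasis i)) l with hφ
  have hbf : ∀ j x x', bform (φ j) (τ x) (τ x') = quatForm (r j * x) x' := by
    intro j x x'
    rw [hφ, bform_normalForm a' b' (fun i => N'.closedBasis i), hyr, hτe, hτe]
  refine model_iso_of_operators h2 ha hb M' N'.finrank_V N'.finrank_W_zero (M'.W 0).subtype
    Subtype.val_injective (fun u => u.2) τ (LinearMap.mulLeft k p) (LinearMap.mulLeft k q)
    (fun x => ?_) (fun x => ?_) (fun x => ?_) φ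
    (fun j => sum_mem fun l _ => Submodule.smul_mem _ _ (normalForm_mem _ l)) (fun x x' => ?_)
    (fun x x' => ?_) (fun x h => ?_) (fun j => ⟨∑ l, y j l • N'.basis (Sum.inr l), ?_⟩)
  · simp only [LinearMap.mulLeft_apply]
    rw [← mul_assoc, hpp, smul_mul_assoc, one_mul]
  · simp only [LinearMap.mulLeft_apply]
    rw [← mul_assoc, hqq, smul_mul_assoc, one_mul]
  · simp only [LinearMap.mulLeft_apply]
    rw [← mul_assoc, hpq, neg_mul, mul_assoc]
  · rw [hbf, hbf, LinearMap.mulLeft_apply, ← mul_assoc]; rfl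
  · rw [hbf, hbf, LinearMap.mulLeft_apply, ← mul_assoc]; rfl
  · apply hcancel
    refine quatForm_nondegenerate fun x' => ?_
    exact (hbf 0 x x').symm.trans (h x')
  · simp only [hφ, map_sum, map_smul, N'.map_subtype_normalForm, N'.d_inr]
    rfl

end NormalBasis

end Comparison

end TwoStepMinimal

end

/-! ### The bijection of isomorphism classes -/

theorem mainTheorem5 (k : Type u) [Field k] (hk : ringChar k ≠ 2) :
    Cardinal.mk (Quotient (TwoStepMinimal.algebraSetoid k)) =
      Cardinal.lift.{u + 1} (Cardinal.mk (Quotient (TwoStepMinimal.quaternionSetoid k))) := by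
  have h2 : (2 : k) ≠ 0 := Ring.two_ne_zero hk
  let m : kˣ × kˣ → TwoStepMinimal.SmoothConicAlgebra k := fun p =>
    ⟨TwoStepMinimal.model p.1 p.2, (TwoStepMinimal.modelNormalBasis _ _).isTypeFourThree,
      (TwoStepMinimal.modelNormalBasis _ _).cutsSmoothConic h2 p.1.ne_zero p.2.ne_zero⟩
  let F : Quotient (TwoStepMinimal.quaternionSetoid k) → Quotient (TwoStepMinimal.algebraSetoid k) :=
    Quotient.map m fun p q ⟨e⟩ => (TwoStepMinimal.modelNormalBasis _ _).model_iso_of_algEquiv h2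
      p.1.ne_zero p.2.ne_zero q.1.ne_zero q.2.ne_zero e
  have hF : Function.Bijective F := by
    constructor
    · rintro ⟨p⟩ ⟨q⟩ h
      exact Quotient.sound ((TwoStepMinimal.modelNormalBasis _ _).algEquiv_of_iso
        (TwoStepMinimal.modelNormalBasis _ _) (Quotient.exact h))
    · rintro ⟨M, hM, hQ⟩
      obtain ⟨a, b, hab⟩ := TwoStepMinimal.exists_iso_model h2 M hM hQ
      exact ⟨Quotient.mk _ (a, b), Quotient.sound hab⟩
  rw [← Cardinal.mk_uLift]
  exact Cardinal.mk_congr (Equiv.ulift.trans (Equiv.ofBijective F hF)).symm
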